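/- Let $p>3$ and $q>3$ be integers and consider the regular planar mosaic with Schläfli symbol $\{p,q\}$ (cells are $p$-gons, $q$ of them at every vertex; the mosaic is hyperbolic, except for $\{4,4\}$, which is Euclidean). Fix a vertex $B_0$. Belt $0$ is $B_0$; belt $1$ consists of the cells having a common point with $B_0$; for $i\ge 1$, belt $i+1$ consists of the cells that have a common point with belt $i$ but not with belt $i-1$. Level $0$ is $\{B_0\}$, and for $i\ge1$ level $i$ is the set of vertices on the outer boundary of belt $i$. Trees are constructed by choosing edges of the mosaic joining consecutive levels (never two vertices of the same level) such that every vertex is connected to at most one vertex of the previous level, every vertex is connected to at least one vertex of the next level, and, subject to this, the number of chosen edges between any two consecutive levels is maximal. A vertex on level $i$ that is not connected to level $i-1$ by a chosen edge is called a root; let $b_i$ be the number of roots on level $i$ and $a_i$ the number of the other vertices on level $i$. Then such a construction exists, and for every such construction all the $a_i$ and $b_i$ are finite, $a_1=q$, $b_1=q(p-3)$, and for every $i\ge 1$ $$a_{i+1}=(q-3)\,a_i+(q-2)\,b_i,$$ $$b_{i+1}=\big((q-3)(p-3)-1\big)a_i+\big((q-2)(p-3)-1\big)b_i .$$ -/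

import Mathlib

namespace Mosaic

/-- The Coxeter matrix of the group `[p,q]`: the full symmetry group of the regular planar mosaic
with Schläfli symbol `{p,q}`. It is generated by the reflections `ρ₀, ρ₁, ρ₂` in the sides of a
right triangle with angles `π/p` (at the centre of a cell) and `π/q` (at a vertex), with the
relations `ρ₀² = ρ₁² = ρ₂² = (ρ₀ρ₁)^p = (ρ₁ρ₂)^q = (ρ₀ρ₂)² = 1`. -/
def schlafli (p q : ℕ) (hp : 2 ≤ p) (hq : 2 ≤ q) : CoxeterMatrix (Fin 3) where
  M := !![1, p, 2; p, 1, q; 2, q, 1]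
  isSymm := by
    ext i j
    fin_cases i <;> fin_cases j <;> rfl
  diagonal i := by fin_cases i <;> rfl
  off_diagonal i j h := by
    fin_cases i <;> fin_cases j <;> simp at h ⊢ <;> omega

/-- The subgroup generated by two of the three reflections. -/
def pairSubgroup (M : CoxeterMatrix (Fin 3)) (i j : Fin 3) : Subgroup M.Group :=
  Subgroup.closure {M.simple i, M.simple j}

/-- The symmetry group acts simply transitively on the flags (vertex, edge, cell) of the mosaic, so
that its elements are the flags. A vertex is the set of flags through it: a left coset of the
stabilizer `⟨ρ₁, ρ₂⟩` of the base vertex. -/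
abbrev Vertex (M : CoxeterMatrix (Fin 3)) : Type := M.Group ⧸ pairSubgroup M 1 2

/-- An edge of the mosaic: a left coset of the stabilizer `⟨ρ₀, ρ₂⟩` of the base edge. -/
abbrev Edge (M : CoxeterMatrix (Fin 3)) : Type := M.Group ⧸ pairSubgroup M 0 2

/-- A cell (tile) of the mosaic: a left coset of the stabilizer `⟨ρ₀, ρ₁⟩` of the base cell. -/
abbrev Cell (M : CoxeterMatrix (Fin 3)) : Type := M.Group ⧸ pairSubgroup M 0 1

variable {M : CoxeterMatrix (Fin 3)}

/-- The vertex `v` is an endpoint of the edge `e`: some flag contains both. -/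
def Vertex.OnEdge (v : Vertex M) (e : Edge M) : Prop :=
  ∃ g : M.Group, (QuotientGroup.mk g : Vertex M) = v ∧ (QuotientGroup.mk g : Edge M) = e

/-- The vertex `v` is a vertex of the cell `c`: some flag contains both. -/
def Vertex.OnCell (v : Vertex M) (c : Cell M) : Prop :=
  ∃ g : M.Group, (QuotientGroup.mk g : Vertex M) = v ∧ (QuotientGroup.mk g : Cell M) = c

/-- The lattice as a graph: two different vertices are adjacent if they are the endpoints of an
edge of the mosaic. -/
def lattice (M : CoxeterMatrix (Fin 3)) : SimpleGraph (Vertex M) where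
  Adj u v := u ≠ v ∧ ∃ e : Edge M, u.OnEdge e ∧ v.OnEdge e
  symm := ⟨fun _ _ h => ⟨h.1.symm, h.2.imp fun _ he => ⟨he.2, he.1⟩⟩⟩
  loopless := ⟨fun _ h => h.1 rfl⟩

/-- Two cells have a common point. The mosaic is edge-to-edge: the intersection of two different
cells is empty, a vertex, or an edge with its two endpoints, so that a common point exists
exactly if there is a common vertex. -/
def Cell.Meets (c d : Cell M) : Prop := ∃ v : Vertex M, v.OnCell c ∧ v.OnCell d

/-- The cells of the belts around the vertex `o`. Belt `0` is the vertex `o` itself and contains no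
cell; belt `1` consists of the cells having a common point with `o`; belt `i + 1` consists of the
cells that have a common point with belt `i`, but not with belt `i - 1`. -/
def belt (o : Vertex M) : ℕ → Set (Cell M)
  | 0 => ∅
  | 1 => {c | o.OnCell c}
  | 2 => {c | (∃ d ∈ belt o 1, c.Meets d) ∧ ¬ o.OnCell c}
  | i + 3 => {c | (∃ d ∈ belt o (i + 2), c.Meets d) ∧ ¬ ∃ d ∈ belt o (i + 1), c.Meets d}

/-- The vertices on level (layer) `i` around `o`. Level `0` is `o`. For `i ≥ 1` level `i` is the
outer boundary of belt `i`: the vertices of cells of belt `i` that also lie on a cell outside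
the region covered by the belts up to `i`. -/
def level (o : Vertex M) : ℕ → Set (Vertex M)
  | 0 => {o}
  | i + 1 => {v | (∃ c ∈ belt o (i + 1), v.OnCell c) ∧
      ∃ c : Cell M, v.OnCell c ∧ ∀ j ≤ i + 1, c ∉ belt o j}

/-- The edges of `F` between level `i` and level `i + 1`, written from the inner to the outer
endpoint. -/
def edgesBetween (o : Vertex M) (F : SimpleGraph (Vertex M)) (i : ℕ) :
    Set (Vertex M × Vertex M) :=
  {e | e.1 ∈ level o i ∧ e.2 ∈ level o (i + 1) ∧ F.Adj e.1 e.2}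

/-- `F` is a selection of edges of the lattice that is admissible for the trees: its edges join
consecutive levels (never two vertices of the same level), a vertex is connected to at most one
vertex of the previous level, and no vertex is a leaf, that is, every vertex is connected to some
vertex of the next level. -/
structure IsAdmissible (o : Vertex M) (F : SimpleGraph (Vertex M)) : Prop where
  le_lattice : F ≤ lattice M
  consecutive : ∀ u v, F.Adj u v →
    ∃ i, (u, v) ∈ edgesBetween o F i ∨ (v, u) ∈ edgesBetween o F i
  unique_parent : ∀ i u u' v, (u, v) ∈ edgesBetween o F i → (u', v) ∈ edgesBetween o F i → u = u'
  no_leaf : ∀ i, ∀ u ∈ level o i, ∃ v, (u, v) ∈ edgesBetween o F i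

/-- `F` is the edge set of the trees built from the main root `o`: it is admissible and uses the
maximum number of edges between any two consecutive levels. -/
structure IsTreeConstruction (o : Vertex M) (F : SimpleGraph (Vertex M)) : Prop
    extends IsAdmissible o F where
  maximum : ∀ F', IsAdmissible o F' → ∀ i,
    (edgesBetween o F' i).encard ≤ (edgesBetween o F i).encard

/-- The vertices `A` on level `i`: those connected by an edge of the trees to the previous level. -/
def nonRoots (o : Vertex M) (F : SimpleGraph (Vertex M)) (i : ℕ) : Set (Vertex M) :=
  {v | ∃ j u, j + 1 = i ∧ (u, v) ∈ edgesBetween o F j}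

/-- The vertices `B` on level `i`: the rest of the level, which are the roots of trees. -/
def roots (o : Vertex M) (F : SimpleGraph (Vertex M)) (i : ℕ) : Set (Vertex M) :=
  level o i \ nonRoots o F i

end Mosaic

/-!
Seen from the base vertex, the mosaic has a simple combinatorial structure. Every level is a closed
polygon. A vertex on it has two neighbours on the level, at most one on the previous level (since
`p > 3`), and all its other edges lead outwards, to its children; there is at least one since `q > 3`.
A cell of the next belt touches the level either in a vertex or in an edge, and so, going along the
next level, there are `p - 3` vertices which are not children between two consecutive children of the
same vertex, and `p - 4` between the last child of a vertex and the first child of its right neighbour.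
Hence all edges between consecutive levels together are admissible, so that a tree construction must
use all of them; its roots are the vertices that are not children. A vertex with `d` children accounts
for `d` nonroots and `d (p - 3) - 1` roots on the next level, where `d` is `q - 3` for a nonroot and
`q - 2` for a root, which is the recursion; the base vertex accounts for `q` and `q (p - 3)`.

What needs proof is that the mosaic, given as the set of cosets in the Coxeter group `[p,q]`, has
this structure. The structure is written down as a model: vertices are addresses (`Addr`), darts
(directed edges) are vertices with an edge number in `ZMod q`, and the cyclic order on a level is the
odometer `next`. All faces of the model are `p`-gons (`turn_iterate_period`), hence the Coxeter group
acts on the flags of the model (`isLiftable_flagPerm`). So flags of the mosaic map to flags of the model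
(`toFlag`). Conversely, every flag of the model is given a group element (`flagElt`), by recursion on
the address, and the relations of the group show that this is compatible with passing to adjacent
flags (`flagElt_reflect`, `leftDartElt_next`). The two maps are inverse to each other
(`flagElt_toFlag`, `toFlag_flagElt`), and the mosaic is the model.

Belts and levels are then recognized from local properties of the numbering of vertices by the length
of their address (`IsLevelFunction.mem_belt_iff`, `IsLevelFunction.mem_level_iff`).
-/

namespace Mosaic

/-! ### Addresses of vertices -/

/-- The address of a vertex. The base vertex is `[]`; if `v` is the address of a vertex on level `i`,
then `(k, j) :: v` is the vertex of level `i + 1` that follows the `k`-th child of `v` (counted from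
`1`, clockwise) after `j` steps along that level. So the vertices with `j = 0` are the ones joined to
the previous level. -/
abbrev Addr : Type := List (ℕ × ℕ)

/-- The number of edges from the vertex to the next level. Of the `q` edges at a vertex other than the
base vertex, two run along its level and, if it is a child (`x.2 = 0`), one leads to its parent. -/
def deg (q : ℕ) : Addr → ℕ
  | [] => q
  | x :: _ => if x.2 = 0 then q - 3 else q - 2

/-- The number of addresses `(k, j) :: v`, which is the distance along the level from the `k`-th
child of `v` to the next child. The two children and the part of the level between them lie on one
`p`-gon, together with `v` alone, or with `v` and its right neighbour if `k` is the last
child and `v` is not the base vertex. -/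
def width (p q : ℕ) (v : Addr) (k : ℕ) : ℕ :=
  if v ≠ [] ∧ k = deg q v then p - 3 else p - 2

/-- The addresses that belong to a vertex of the mosaic. -/
def Valid (p q : ℕ) : Addr → Prop
  | [] => True
  | x :: v => Valid p q v ∧ (1 ≤ x.1 ∧ x.1 ≤ deg q v) ∧ x.2 < width p q v x.1

/-- The clockwise neighbour on the same level. It is computed like the successor of an odometer, the
head of the list being the fastest digit; for the base vertex it is the vertex itself. -/
def next (p q : ℕ) : Addr → Addr
  | [] => []
  | x :: v =>
    if x.2 + 1 < width p q v x.1 then (x.1, x.2 + 1) :: v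
    else if x.1 < deg q v then (x.1 + 1, 0) :: v
    else (1, 0) :: next p q v

/-- The counterclockwise neighbour on the same level, inverse to `next`. -/
def prev (p q : ℕ) : Addr → Addr
  | [] => []
  | x :: v =>
    if 0 < x.2 then (x.1, x.2 - 1) :: v
    else if 1 < x.1 then (x.1 - 1, width p q v (x.1 - 1) - 1) :: v
    else (deg q (prev p q v), width p q (prev p q v) (deg q (prev p q v)) - 1) :: prev p q v

section Model

variable {p q : ℕ}

@[simp] theorem length_next (v : Addr) : (next p q v).length = v.length := by
  induction v with
  | nil => rfl
  | cons x v ih => simp only [next]; split_ifs <;> simp [ih]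

@[simp] theorem length_prev (v : Addr) : (prev p q v).length = v.length := by
  induction v with
  | nil => rfl
  | cons x v ih => simp only [prev]; split_ifs <;> simp [ih]

theorem next_ne_nil {v : Addr} (h : v ≠ []) : next p q v ≠ [] := by
  rw [← List.length_pos_iff_ne_nil] at *; simpa

theorem prev_ne_nil {v : Addr} (h : v ≠ []) : prev p q v ≠ [] := by
  rw [← List.length_pos_iff_ne_nil] at *; simpa

theorem one_le_deg (hq : 3 < q) (v : Addr) : 1 ≤ deg q v := by
  cases v <;> simp only [deg] <;> try split_ifs
  all_goals omega

theorem one_le_width (hp : 3 < p) (v : Addr) (k : ℕ) : 1 ≤ width p q v k := by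
  simp only [width]; split_ifs <;> omega

theorem Valid.next (hp : 3 < p) (hq : 3 < q) {v : Addr} (h : Valid p q v) :
    Valid p q (next p q v) := by
  induction v with
  | nil => trivial
  | cons x v ih =>
    obtain ⟨hv, hk, hj⟩ := h
    simp only [Mosaic.next]
    split_ifs with h1 h2
    · exact ⟨hv, hk, h1⟩
    · exact ⟨hv, ⟨by simp, h2⟩, one_le_width hp _ _⟩
    · exact ⟨ih hv, ⟨le_rfl, one_le_deg hq _⟩, one_le_width hp _ _⟩

theorem Valid.prev (hp : 3 < p) (hq : 3 < q) {v : Addr} (h : Valid p q v) :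
    Valid p q (prev p q v) := by
  induction v with
  | nil => trivial
  | cons x v ih =>
    obtain ⟨hv, hk, hj⟩ := h
    simp only [Mosaic.prev]
    split_ifs with h1 h2
    · exact ⟨hv, hk, by dsimp only; omega⟩
    · have := one_le_width (q := q) hp v (x.1 - 1)
      exact ⟨hv, ⟨by dsimp only; omega, by dsimp only; omega⟩, by dsimp only; omega⟩
    · have := one_le_width (q := q) hp (Mosaic.prev p q v) (deg q (Mosaic.prev p q v))
      exact ⟨ih hv, ⟨one_le_deg hq _, le_rfl⟩, by dsimp only; omega⟩

theorem prev_next {v : Addr} (h : Valid p q v) :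
    prev p q (next p q v) = v := by
  induction v with
  | nil => rfl
  | cons x v ih =>
    obtain ⟨hv, ⟨h1, h2⟩, hj⟩ := h
    have hw : x.2 = width p q v x.1 - 1 ∨ x.2 + 1 < width p q v x.1 := by omega
    simp only [next]
    split_ifs with h3 h4
    · simp [prev]
    · have : x.2 = width p q v x.1 - 1 := by omega
      simp [prev, show 0 < x.1 from h1, ← this]
    · have h5 : x.1 = deg q v := by omega
      have h6 : x.2 = width p q v x.1 - 1 := by omega
      simp only [prev, ih hv, lt_irrefl, if_false, ← h5, ← h6]

theorem next_prev (hp : 3 < p) {v : Addr} (h : Valid p q v) :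
    next p q (prev p q v) = v := by
  induction v with
  | nil => rfl
  | cons x v ih =>
    obtain ⟨k, j⟩ := x
    obtain ⟨hv, ⟨h1, h2⟩, hj⟩ := h
    dsimp only at h1 h2 hj
    simp only [prev]
    split_ifs with h3 h4
    · simp only [next]
      rw [if_pos (by omega), Nat.sub_add_cancel h3]
    · have := one_le_width (q := q) hp v (k - 1)
      simp only [next]
      rw [if_neg (by omega), if_pos (by omega), Nat.sub_add_cancel h1]
      simp; omega
    · have := one_le_width (q := q) hp (prev p q v) (deg q (prev p q v))
      simp only [next]
      rw [if_neg (by omega), if_neg (by omega), ih hv]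
      simp; omega

/-! ### Reversal of darts -/

/-- The reversal of a dart. A dart is a vertex `v` with the number `x : ZMod q` of one of its edges,
in clockwise order: `0` leads to the left neighbour `prev v`, then `1, …, deg v` lead to the
children, `deg v + 1` to the right neighbour `next v`, and, if `v` is a child, `-1` to its parent. At the
base vertex all darts lead to children, the last one being `q = 0`. -/
def flip (p q : ℕ) : Addr × ZMod q → Addr × ZMod q
  | ([], x) => ([(if x.val = 0 then q else x.val, 0)], -1)
  | (y :: w, x) =>
    if x.val = 0 then (prev p q (y :: w), ((deg q (prev p q (y :: w)) + 1 : ℕ) : ZMod q))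
    else if x.val ≤ deg q (y :: w) then ((x.val, 0) :: y :: w, -1)
    else if x.val = deg q (y :: w) + 1 then (next p q (y :: w), 0)
    else (w, y.1)

theorem deg_cons_lt (hq : 3 < q) (x : ℕ × ℕ) (v : Addr) : deg q (x :: v) + 1 < q := by
  simp only [deg]; split_ifs <;> omega

theorem flip_child (hq : 3 < q) (v : Addr) {k : ℕ} (h1 : 1 ≤ k) (h2 : k ≤ deg q v) :
    flip p q (v, k) = ((k, 0) :: v, -1) := by
  cases v with
  | nil =>
    rcases h2.lt_or_eq with h | h
    · have h : k < q := h
      simp [flip, ZMod.val_natCast, Nat.mod_eq_of_lt h]; omega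
    · have h : k = q := h
      subst h; simp [flip]
  | cons y w =>
    have := deg_cons_lt hq y w
    have hk : k % q = k := Nat.mod_eq_of_lt (by omega)
    simp only [flip, ZMod.val_natCast, hk]
    rw [if_neg (by omega), if_pos h2]

theorem flip_left {v : Addr} (hv : v ≠ []) :
    flip p q (v, 0) = (prev p q v, ((deg q (prev p q v) + 1 : ℕ) : ZMod q)) := by
  cases v with
  | nil => exact absurd rfl hv
  | cons y w => simp [flip]

theorem flip_right (hq : 3 < q) {v : Addr} (hv : v ≠ []) :
    flip p q (v, ((deg q v + 1 : ℕ) : ZMod q)) = (next p q v, 0) := by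
  cases v with
  | nil => exact absurd rfl hv
  | cons y w =>
    have := deg_cons_lt hq y w
    have hk : (deg q (y :: w) + 1) % q = deg q (y :: w) + 1 := Nat.mod_eq_of_lt (by omega)
    simp only [flip, ZMod.val_natCast, hk]
    rw [if_neg (by omega), if_neg (by omega)]
    exact if_pos trivial

theorem neg_one_eq_natCast (hq : 3 < q) : (-1 : ZMod q) = ((q - 1 : ℕ) : ZMod q) := by
  rw [Nat.cast_sub (by omega)]; simp

theorem val_neg_one_eq (hq : 3 < q) : (-1 : ZMod q).val = q - 1 := by
  rw [neg_one_eq_natCast hq, ZMod.val_natCast, Nat.mod_eq_of_lt (by omega)]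

theorem flip_parent (hq : 3 < q) (k : ℕ) (v : Addr) : flip p q ((k, 0) :: v, -1) = (v, (k : ZMod q)) := by
  simp only [flip, val_neg_one_eq hq, deg, if_true]
  rw [if_neg (by omega), if_neg (by omega), if_neg (by omega)]

/-- A dart leads to a child, to the left, to the right or to the parent. -/
theorem dart_cases (hq : 3 < q) (v : Addr) (x : ZMod q) :
    (∃ k : ℕ, 1 ≤ k ∧ k ≤ deg q v ∧ x = k) ∨ (v ≠ [] ∧ x = 0) ∨
    (v ≠ [] ∧ x = (deg q v + 1 : ℕ)) ∨ ∃ k w, v = (k, 0) :: w ∧ x = -1 := by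
  have : NeZero q := ⟨by omega⟩
  have hx : ((x.val : ℕ) : ZMod q) = x := ZMod.natCast_zmod_val x
  have hlt := x.val_lt
  cases v with
  | nil =>
    left
    by_cases h : x.val = 0
    · exact ⟨q, by omega, le_rfl, by rw [← hx, h]; simp⟩
    · exact ⟨x.val, by omega, hlt.le, hx.symm⟩
  | cons y w =>
    by_cases h : x.val = 0
    · exact Or.inr (Or.inl ⟨by simp, by rw [← hx, h]; simp⟩)
    by_cases h1 : x.val ≤ deg q (y :: w)
    · exact Or.inl ⟨x.val, by omega, h1, hx.symm⟩
    by_cases h2 : x.val = deg q (y :: w) + 1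
    · exact Or.inr (Or.inr (Or.inl ⟨by simp, by rw [← h2, hx]⟩))
    · obtain ⟨k, j⟩ := y
      simp only [deg] at h1 h2
      have hj : j = 0 := by split_ifs at h1 h2 with hj <;> [exact hj; omega]
      subst hj
      simp only [if_true] at h1 h2
      refine Or.inr (Or.inr (Or.inr ⟨k, w, rfl, ?_⟩))
      rw [neg_one_eq_natCast hq, ← hx]; congr 1; omega

theorem flip_flip (hp : 3 < p) (hq : 3 < q) {v : Addr} (hv : Valid p q v) (x : ZMod q) :
    flip p q (flip p q (v, x)) = (v, x) := by
  rcases dart_cases hq v x with ⟨k, h1, h2, rfl⟩ | ⟨h, rfl⟩ | ⟨h, rfl⟩ | ⟨k, w, rfl, rfl⟩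
  · rw [flip_child hq v h1 h2, flip_parent hq]
  · rw [flip_left h, flip_right hq (prev_ne_nil h), next_prev hp hv]
  · rw [flip_right hq h, flip_left (next_ne_nil h), prev_next hv]
  · rw [flip_parent hq, flip_child hq w hv.2.1.1 hv.2.1.2]

theorem Valid.flip (hp : 3 < p) (hq : 3 < q) {v : Addr} (hv : Valid p q v) (x : ZMod q) :
    Valid p q (flip p q (v, x)).1 := by
  rcases dart_cases hq v x with ⟨k, h1, h2, rfl⟩ | ⟨h, rfl⟩ | ⟨h, rfl⟩ | ⟨k, w, rfl, rfl⟩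
  · rw [flip_child hq v h1 h2]
    exact ⟨hv, ⟨h1, h2⟩, one_le_width hp _ _⟩
  · rw [flip_left h]; exact hv.prev hp hq
  · rw [flip_right hq h]; exact hv.next hp hq
  · rw [flip_parent hq]; exact hv.1

/-! ### Face cycles -/

/-- One step around a cell: cross to the other end of the edge, then take the neighbouring dart in
the counterclockwise direction. The orbits are the cells, each lying on the right of its darts. -/
def turn (p q : ℕ) (d : Addr × ZMod q) : Addr × ZMod q :=
  ((flip p q d).1, (flip p q d).2 - 1)

theorem turn_child (hq : 3 < q) (v : Addr) {k : ℕ} (h1 : 1 ≤ k) (h2 : k ≤ deg q v) :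
    turn p q (v, k) = ((k, 0) :: v, ((deg q ((k, 0) :: v) + 1 : ℕ) : ZMod q)) := by
  have : deg q ((k, 0) :: v) + 1 = q - 1 - 1 := by simp only [deg, if_true]; omega
  rw [turn, flip_child hq v h1 h2, neg_one_eq_natCast hq, this, Nat.cast_sub (n := q - 1) (by omega)]
  simp

theorem turn_left {v : Addr} (hv : v ≠ []) :
    turn p q (v, 0) = (prev p q v, (deg q (prev p q v) : ZMod q)) := by
  simp [turn, flip_left hv]

theorem turn_right (hq : 3 < q) {v : Addr} (hv : v ≠ []) :
    turn p q (v, ((deg q v + 1 : ℕ) : ZMod q)) = (next p q v, -1) := by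
  rw [turn, flip_right hq hv]; simp

theorem turn_parent (hq : 3 < q) {k : ℕ} (hk : 1 ≤ k) (v : Addr) :
    turn p q ((k, 0) :: v, -1) = (v, ((k - 1 : ℕ) : ZMod q)) := by
  rw [turn, flip_parent hq, Nat.cast_sub hk]; simp

theorem turn_iterate_child (hq : 3 < q) (v : Addr) {k j : ℕ} (h1 : 1 ≤ k) (h2 : k ≤ deg q v)
    (hj : j < width p q v k) :
    (turn p q)^[j + 1] (v, k) = ((k, j) :: v, ((deg q ((k, j) :: v) + 1 : ℕ) : ZMod q)) := by
  induction j with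
  | zero => exact turn_child hq v h1 h2
  | succ j ih =>
    rw [Function.iterate_succ_apply', ih (by omega), turn_right hq (by simp), next, if_pos hj,
      neg_one_eq_natCast hq]
    have : deg q ((k, j + 1) :: v) + 1 = q - 1 := by simp [deg]; omega
    rw [this]

/-- Once around the outer side of a cell: from the dart to the `k`-th child of `v`, along the next
level, up to the dart from the next child to its parent. -/
theorem turn_iterate_width (hp : 3 < p) (hq : 3 < q) (v : Addr) {k : ℕ} (h1 : 1 ≤ k)
    (h2 : k ≤ deg q v) :
    (turn p q)^[width p q v k + 1] (v, k) =
      ((if k < deg q v then (k + 1, 0) :: v else (1, 0) :: next p q v), -1) := by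
  have hw := one_le_width (q := q) hp v k
  obtain ⟨j, hj⟩ : ∃ j, width p q v k = j + 1 := ⟨_, (Nat.sub_add_cancel hw).symm⟩
  rw [Function.iterate_succ_apply', hj, turn_iterate_child hq v h1 h2 (by omega),
    turn_right hq (by simp), next, if_neg (by simp [hj])]

theorem turn_iterate_of_lt (hp : 3 < p) (hq : 3 < q) (v : Addr) {k : ℕ} (h1 : 1 ≤ k)
    (h2 : k < deg q v) : (turn p q)^[p] (v, k) = (v, (k : ZMod q)) := by
  have hw : width p q v k + 1 + 1 = p := by simp only [width]; rw [if_neg (by omega)]; omega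
  have hi : (turn p q)^[p] = (turn p q)^[width p q v k + 1 + 1] := by rw [hw]
  rw [hi, Function.iterate_succ_apply', turn_iterate_width hp hq v h1 h2.le, if_pos h2,
    turn_parent hq (by omega), Nat.add_sub_cancel]

theorem turn_iterate_last (hp : 3 < p) (hq : 3 < q) (v : Addr) :
    (turn p q)^[width p q v (deg q v) + 2] (v, (deg q v : ZMod q)) = (next p q v, 0) := by
  rw [Function.iterate_succ_apply', turn_iterate_width hp hq v (one_le_deg hq v) le_rfl,
    if_neg (lt_irrefl _), turn_parent hq le_rfl]
  simp

theorem turn_iterate_period_child (hp : 3 < p) (hq : 3 < q) {v : Addr} (hv : Valid p q v) {k : ℕ}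
    (h1 : 1 ≤ k) (h2 : k ≤ deg q v) : (turn p q)^[p] (v, k) = (v, (k : ZMod q)) := by
  rcases h2.lt_or_eq with h | rfl
  · exact turn_iterate_of_lt hp hq v h1 h
  have hl := turn_iterate_last hp hq v
  cases v with
  | nil =>
    have hw : width p q [] (deg q []) + 2 = p := by simp [width]; omega
    rw [hw] at hl
    rw [hl]; simp [next, deg]
  | cons y w =>
    have hw : width p q (y :: w) (deg q (y :: w)) + 2 + 1 = p := by simp [width]; omega
    have hi : (turn p q)^[p] = (turn p q)^[width p q (y :: w) (deg q (y :: w)) + 2 + 1] := by rw [hw]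
    rw [hi, Function.iterate_succ_apply', hl, turn_left (next_ne_nil (by simp)), prev_next hv]

/-- Every cell contains a dart that leads to a child. -/
theorem exists_turn_iterate (hp : 3 < p) (hq : 3 < q) {u : Addr} (hu : Valid p q u) (x : ZMod q) :
    ∃ (v : Addr) (k m : ℕ), Valid p q v ∧ 1 ≤ k ∧ k ≤ deg q v ∧
      (turn p q)^[m] (v, k) = (u, x) := by
  rcases dart_cases hq u x with ⟨k, h1, h2, rfl⟩ | ⟨h, rfl⟩ | ⟨h, rfl⟩ | ⟨k, w, rfl, rfl⟩
  · exact ⟨u, k, 0, hu, h1, h2, rfl⟩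
  · refine ⟨prev p q u, deg q (prev p q u), _, hu.prev hp hq, one_le_deg hq _, le_rfl,
      (turn_iterate_last hp hq _).trans ?_⟩
    rw [next_prev hp hu]
  · cases u with
    | nil => exact absurd rfl h
    | cons y w =>
      obtain ⟨k, j⟩ := y
      exact ⟨w, k, j + 1, hu.1, hu.2.1.1, hu.2.1.2, turn_iterate_child hq w hu.2.1.1 hu.2.1.2 hu.2.2⟩
  · obtain ⟨hw, ⟨h1, h2⟩, -⟩ := hu
    dsimp only at h1 h2
    by_cases hk : k = 1
    · subst hk
      refine ⟨prev p q w, deg q (prev p q w), _, hw.prev hp hq, one_le_deg hq _, le_rfl,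
        (turn_iterate_width hp hq _ (one_le_deg hq _) le_rfl).trans ?_⟩
      rw [if_neg (lt_irrefl _), next_prev hp hw]
    · refine ⟨w, k - 1, _, hw, by omega, by omega,
        (turn_iterate_width hp hq _ (by omega) (by omega)).trans ?_⟩
      rw [if_pos (by omega), Nat.sub_add_cancel h1]

/-- All cells are `p`-gons. -/
theorem turn_iterate_period (hp : 3 < p) (hq : 3 < q) {u : Addr} (hu : Valid p q u) (x : ZMod q) :
    (turn p q)^[p] (u, x) = (u, x) := by
  obtain ⟨v, k, m, hv, h1, h2, h⟩ := exists_turn_iterate hp hq hu x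
  rw [← h, ← Function.iterate_add_apply, Nat.add_comm, Function.iterate_add_apply,
    turn_iterate_period_child hp hq hv h1 h2]

/-! ### Levels of cells on darts -/

/-- The belt that contains the cell on the right of a dart: the darts to the right neighbour and to the
parent bound a cell on the inner side of the level of their vertex, all others one on the outer side. -/
def dartCellLevel (q : ℕ) (d : Addr × ZMod q) : ℕ :=
  if d.1 ≠ [] ∧ deg q d.1 < d.2.val then d.1.length else d.1.length + 1

theorem dartCellLevel_child (v : Addr) {k : ℕ} (hk : k ≤ deg q v) :
    dartCellLevel q (v, (k : ZMod q)) = v.length + 1 := by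
  rw [dartCellLevel, if_neg]
  rintro ⟨h1, h2⟩
  have := Nat.mod_le k q
  dsimp only at h2
  rw [ZMod.val_natCast] at h2
  omega

theorem dartCellLevel_left (v : Addr) : dartCellLevel q (v, (0 : ZMod q)) = v.length + 1 := by
  simpa using dartCellLevel_child v (k := 0) (Nat.zero_le _)

theorem dartCellLevel_right (hq : 3 < q) {v : Addr} (hv : v ≠ []) :
    dartCellLevel q (v, ((deg q v + 1 : ℕ) : ZMod q)) = v.length := by
  cases v with
  | nil => exact absurd rfl hv
  | cons y w =>
    rw [dartCellLevel, if_pos]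
    refine ⟨hv, ?_⟩
    rw [ZMod.val_natCast, Nat.mod_eq_of_lt (deg_cons_lt hq y w)]
    exact Nat.lt_succ_self _

theorem dartCellLevel_neg_one (hq : 3 < q) {v : Addr} (hv : v ≠ []) :
    dartCellLevel q (v, (-1 : ZMod q)) = v.length := by
  cases v with
  | nil => exact absurd rfl hv
  | cons y w =>
    have := deg_cons_lt hq y w
    rw [dartCellLevel, if_pos]
    refine ⟨hv, ?_⟩
    rw [val_neg_one_eq hq]
    dsimp only
    omega

theorem dartCellLevel_turn (hq : 3 < q) {v : Addr} (hv : Valid p q v) (x : ZMod q) :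
    dartCellLevel q (turn p q (v, x)) = dartCellLevel q (v, x) := by
  rcases dart_cases hq v x with ⟨k, h1, h2, rfl⟩ | ⟨h, rfl⟩ | ⟨h, rfl⟩ | ⟨k, w, rfl, rfl⟩
  · rw [turn_child hq v h1 h2, dartCellLevel_right hq (by simp), dartCellLevel_child v h2]; simp
  · rw [turn_left h, dartCellLevel_child _ le_rfl, dartCellLevel_left]; simp
  · rw [turn_right hq h, dartCellLevel_right hq h, dartCellLevel_neg_one hq (next_ne_nil h)]; simp
  · obtain ⟨hw, ⟨h1, h2⟩, -⟩ := hv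
    dsimp only at h1 h2
    rw [turn_parent hq h1, dartCellLevel_neg_one hq (by simp), dartCellLevel_child _ (by omega)]; simp

/-! ### The rotation system -/

/-- The darts of the model. -/
abbrev Dart (p q : ℕ) : Type := {d : Addr × ZMod q // Valid p q d.1}

/-- The clockwise rotation around the vertex of a dart. -/
def rotation (p q : ℕ) : Equiv.Perm (Dart p q) where
  toFun d := ⟨(d.1.1, d.1.2 + 1), d.2⟩
  invFun d := ⟨(d.1.1, d.1.2 - 1), d.2⟩
  left_inv d := Subtype.ext (by simp)
  right_inv d := Subtype.ext (by simp)

/-- The reversal `flip` as a permutation of the darts. -/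
def reversal (hp : 3 < p) (hq : 3 < q) : Equiv.Perm (Dart p q) :=
  Function.Involutive.toPerm (fun d => ⟨flip p q d.1, d.2.flip hp hq _⟩)
    fun d => Subtype.ext (flip_flip hp hq d.2 _)

theorem reversal_val (hp : 3 < p) (hq : 3 < q) (d : Dart p q) :
    (reversal hp hq d).1 = flip p q d.1 := rfl

theorem reversal_reversal (hp : 3 < p) (hq : 3 < q) (d : Dart p q) :
    reversal hp hq (reversal hp hq d) = d := Subtype.ext (flip_flip hp hq d.2 _)

theorem reversal_mul_self (hp : 3 < p) (hq : 3 < q) :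
    reversal hp hq * reversal hp hq = 1 := Equiv.ext (reversal_reversal hp hq)

theorem rotation_pow_apply (n : ℕ) (d : Dart p q) :
    ((rotation p q ^ n) d).1 = (d.1.1, d.1.2 + n) := by
  induction n with
  | zero => simp
  | succ n ih =>
    rw [pow_succ', Equiv.Perm.mul_apply]
    change ((_ : Addr × ZMod q).1, (_ : Addr × ZMod q).2 + 1) = _
    rw [ih]; simp [add_assoc]

theorem rotation_pow_q : rotation p q ^ q = 1 :=
  Equiv.ext fun d => Subtype.ext (by rw [rotation_pow_apply]; simp)

theorem rotation_inv_mul_reversal_pow_apply (hp : 3 < p) (hq : 3 < q) (n : ℕ) (d : Dart p q) :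
    ((((rotation p q)⁻¹ * reversal hp hq) ^ n) d).1 = (turn p q)^[n] d.1 := by
  induction n with
  | zero => rfl
  | succ n ih =>
    rw [pow_succ', Function.iterate_succ_apply', ← ih]
    rfl

theorem rotation_inv_mul_reversal_pow (hp : 3 < p) (hq : 3 < q) :
    ((rotation p q)⁻¹ * reversal hp hq) ^ p = 1 :=
  Equiv.ext fun d => Subtype.ext <| (rotation_inv_mul_reversal_pow_apply hp hq p d).trans
    (turn_iterate_period hp hq d.2 _)

end Model

/-! ### From a rotation system to an action of the Coxeter group -/

section RotationSystem

variable {D : Type*} (σ α : Equiv.Perm D)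

/-- The three reflections on the flags of a rotation system with rotation `σ` and reversal `α`. A flag
is a dart with one of the two cells at its edge: `(d, false)` has the cell on the right of `d` and
`(d, true)` the one on its left. The reflection `0`, `1`, `2` changes the vertex, the edge, the
cell, respectively, and keeps the other two. -/
def flagReflection : Fin 3 → D × Bool → D × Bool
  | 0, (d, ε) => (α d, !ε)
  | 1, (d, false) => (σ d, true)
  | 1, (d, true) => (σ⁻¹ d, false)
  | 2, (d, ε) => (d, !ε)

variable {σ α}

theorem flagReflection_involutive (hα : α * α = 1) (i : Fin 3) :
    Function.Involutive (flagReflection σ α i) := by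
  have hα' (d : D) : α (α d) = d := DFunLike.congr_fun hα d
  rintro ⟨d, ε⟩
  fin_cases i <;> cases ε <;> simp [flagReflection, hα']

variable (σ) in
/-- `flagReflection` as a permutation of the flags. -/
def flagPerm (hα : α * α = 1) (i : Fin 3) : Equiv.Perm (D × Bool) :=
  (flagReflection_involutive (σ := σ) hα i).toPerm

theorem pow_eq_one_of_apply {f : Equiv.Perm (D × Bool)} {a b : Equiv.Perm D} {n : ℕ}
    (hfa : ∀ d, f (d, false) = (a d, false)) (hfb : ∀ d, f (d, true) = (b d, true))
    (ha : a ^ n = 1) (hb : b ^ n = 1) : f ^ n = 1 := by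
  have key (m : ℕ) (d : D) : (f ^ m) (d, false) = ((a ^ m) d, false) ∧
      (f ^ m) (d, true) = ((b ^ m) d, true) := by
    induction m with
    | zero => simp
    | succ m ih =>
      simp only [pow_succ', Equiv.Perm.mul_apply, ih.1, ih.2, hfa, hfb, and_self]
  ext1 ⟨d, ε⟩
  cases ε <;> simp [(key n d).1, (key n d).2, ha, hb]

theorem mul_pow_eq_one_comm {G : Type*} [Group G] {a b : G} {n : ℕ} (h : (a * b) ^ n = 1) :
    (b * a) ^ n = 1 := by
  have : b * a = a⁻¹ * (a * b) * a⁻¹⁻¹ := by group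
  rw [this, conj_pow, h]; simp

theorem isLiftable_flagPerm {p q : ℕ} (hp : 2 ≤ p) (hq : 2 ≤ q) (hα : α * α = 1)
    (hσ : σ ^ q = 1) (hf : (σ⁻¹ * α) ^ p = 1) :
    (schlafli p q hp hq).IsLiftable (flagPerm σ hα) := by
  have hii (i : Fin 3) : flagPerm σ hα i * flagPerm σ hα i = 1 :=
    Equiv.ext fun x => flagReflection_involutive hα i x
  have hαi : α⁻¹ = α := inv_eq_of_mul_eq_one_left hα
  have h01 : (flagPerm σ hα 0 * flagPerm σ hα 1) ^ p = 1 := by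
    refine pow_eq_one_of_apply (a := α * σ) (b := α * σ⁻¹) (fun _ => rfl) (fun _ => rfl) ?_
      (mul_pow_eq_one_comm hf)
    have : α * σ = (σ⁻¹ * α)⁻¹ := by rw [mul_inv_rev, inv_inv, hαi]
    rw [this, inv_pow, hf, inv_one]
  have h12 : (flagPerm σ hα 2 * flagPerm σ hα 1) ^ q = 1 :=
    pow_eq_one_of_apply (a := σ) (b := σ⁻¹) (fun _ => rfl) (fun _ => rfl) hσ (by rw [inv_pow, hσ, inv_one])
  have h02 : (flagPerm σ hα 0 * flagPerm σ hα 2) ^ 2 = 1 :=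
    pow_eq_one_of_apply (a := α) (b := α) (fun _ => rfl) (fun _ => rfl) (by rw [pow_two, hα])
      (by rw [pow_two, hα])
  intro i j
  fin_cases i <;> fin_cases j
  · exact (pow_one _).trans (hii 0)
  · exact h01
  · exact h02
  · exact mul_pow_eq_one_comm h01
  · exact (pow_one _).trans (hii 1)
  · exact mul_pow_eq_one_comm h12
  · exact mul_pow_eq_one_comm h02
  · exact h12
  · exact (pow_one _).trans (hii 2)

end RotationSystem

/-! ### The action of the symmetry group on flags -/

section Group

variable {p q : ℕ} (hp : 3 < p) (hq : 3 < q)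

/-- The Coxeter matrix of `[p,q]` under the hypotheses `3 < p` and `3 < q`. -/
abbrev coxeter : CoxeterMatrix (Fin 3) :=
  schlafli p q (le_of_lt (lt_of_le_of_lt (by norm_num) hp)) (le_of_lt (lt_of_le_of_lt (by norm_num) hq))

/-- The reflections on the flags of the model. -/
abbrev reflect (i : Fin 3) (x : Dart p q × Bool) : Dart p q × Bool :=
  flagReflection (rotation p q) (reversal hp hq) i x

/-- The flag of the model from which all others are developed. -/
def baseFlag : Dart p q × Bool := (⟨([], 0), trivial⟩, false)

/-- The action of the group `[p,q]` on the flags of the model. -/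
def flagAction : (coxeter hp hq).Group →* Equiv.Perm (Dart p q × Bool) :=
  (coxeter hp hq).toCoxeterSystem.lift
    ⟨flagPerm (rotation p q) (reversal_mul_self hp hq),
      isLiftable_flagPerm _ _ _ rotation_pow_q (rotation_inv_mul_reversal_pow hp hq)⟩

theorem flagAction_simple (i : Fin 3) (x : Dart p q × Bool) :
    flagAction hp hq ((coxeter hp hq).simple i) x = reflect hp hq i x := by
  rw [flagAction, ← CoxeterMatrix.toCoxeterSystem_simple, CoxeterSystem.lift_apply_simple]
  rfl

theorem simple_inv (i : Fin 3) :
    ((coxeter hp hq).simple i)⁻¹ = (coxeter hp hq).simple i := by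
  rw [← CoxeterMatrix.toCoxeterSystem_simple]; exact CoxeterSystem.inv_simple _ i

/-- The flag of the model that corresponds to the flag `g` of the mosaic, if `g₀` is placed at
`baseFlag`. The inverse turns the left action into one by right multiplication, so that adjacent flags
go to adjacent flags (`toFlag_mul_simple`). -/
def toFlag (g₀ g : (coxeter hp hq).Group) : Dart p q × Bool :=
  flagAction hp hq (g⁻¹ * g₀) baseFlag

theorem toFlag_self (g₀ : (coxeter hp hq).Group) : toFlag hp hq g₀ g₀ = baseFlag := by
  simp [toFlag]

theorem toFlag_mul_simple (g₀ g : (coxeter hp hq).Group) (i : Fin 3) :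
    toFlag hp hq g₀ (g * (coxeter hp hq).simple i) = reflect hp hq i (toFlag hp hq g₀ g) := by
  rw [toFlag, mul_inv_rev, simple_inv, mul_assoc, map_mul, Equiv.Perm.mul_apply, flagAction_simple]
  rfl

/-! ### The group element of a flag -/

/-- The clockwise rotation by one edge around the base vertex. -/
def rot : (coxeter hp hq).Group := (coxeter hp hq).simple 1 * (coxeter hp hq).simple 2

/-- The half-turn around the midpoint of the base edge. -/
def halfTurn : (coxeter hp hq).Group := (coxeter hp hq).simple 0 * (coxeter hp hq).simple 2

theorem simple_mul_self (i : Fin 3) :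
    (coxeter hp hq).simple i * (coxeter hp hq).simple i = 1 :=
  CoxeterSystem.simple_mul_simple_self (coxeter hp hq).toCoxeterSystem i

theorem rot_pow : rot hp hq ^ q = 1 :=
  CoxeterSystem.simple_mul_simple_pow (coxeter hp hq).toCoxeterSystem 1 2

theorem halfTurn_mul_self : halfTurn hp hq * halfTurn hp hq = 1 :=
  (pow_two _).symm.trans (CoxeterSystem.simple_mul_simple_pow (coxeter hp hq).toCoxeterSystem 0 2)

theorem rot_inv_mul_halfTurn_pow : ((rot hp hq)⁻¹ * halfTurn hp hq) ^ p = 1 := by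
  have h : ((coxeter hp hq).simple 0 * (coxeter hp hq).simple 1) ^ p = 1 :=
    CoxeterSystem.simple_mul_simple_pow (coxeter hp hq).toCoxeterSystem 0 1
  have : (rot hp hq)⁻¹ * halfTurn hp hq = (coxeter hp hq).simple 2 *
      (((coxeter hp hq).simple 0 * (coxeter hp hq).simple 1)⁻¹) * ((coxeter hp hq).simple 2)⁻¹ := by
    simp only [rot, halfTurn, mul_inv_rev, simple_inv, mul_assoc]
  rw [this, conj_pow, inv_pow, h]; simp


theorem rot_pow_sub_one : rot hp hq ^ (q - 1) = (rot hp hq)⁻¹ := by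
  rw [eq_inv_iff_mul_eq_one, ← pow_succ, Nat.sub_add_cancel (by omega), rot_pow]

theorem halfTurn_mul_pow_sub_two :
    halfTurn hp hq * ((rot hp hq)⁻¹ * halfTurn hp hq) ^ (p - 2) =
      rot hp hq * halfTurn hp hq * rot hp hq := by
  have hx := rot_inv_mul_halfTurn_pow hp hq
  have ha : (halfTurn hp hq)⁻¹ = halfTurn hp hq := inv_eq_of_mul_eq_one_left (halfTurn_mul_self hp hq)
  set x := (rot hp hq)⁻¹ * halfTurn hp hq with hxd
  have h1 : halfTurn hp hq = rot hp hq * x := by simp [hxd]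
  have h2 : x ^ (p - 2 + 1) = x⁻¹ := by
    rw [eq_inv_iff_mul_eq_one, ← pow_succ, ← hx]; congr 1; omega
  have h3 : x⁻¹ = halfTurn hp hq * rot hp hq := by rw [hxd, mul_inv_rev, inv_inv, ha]
  calc halfTurn hp hq * x ^ (p - 2) = rot hp hq * x ^ (p - 2 + 1) := by
        rw [pow_succ', ← mul_assoc, ← h1]
    _ = _ := by rw [h2, h3, mul_assoc]

theorem halfTurn_mul_pow_sub_three :
    halfTurn hp hq * ((rot hp hq)⁻¹ * halfTurn hp hq) ^ (p - 3) =
      rot hp hq * halfTurn hp hq * rot hp hq * halfTurn hp hq * rot hp hq := by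
  have ha : (halfTurn hp hq)⁻¹ = halfTurn hp hq := inv_eq_of_mul_eq_one_left (halfTurn_mul_self hp hq)
  have h := halfTurn_mul_pow_sub_two hp hq
  rw [show p - 2 = p - 3 + 1 by omega, pow_succ, ← mul_assoc, ← eq_mul_inv_iff_mul_eq] at h
  rw [h, mul_inv_rev, inv_inv, ha]
  simp only [mul_assoc]

variable {hp hq} in
/-- The group element of the dart `0` at the vertex with the given address: from `v` rotate to the
`k`-th child and cross over, to its dart `-1`. One more rotation gives the dart `0` of the child, and
each further factor `(rot)⁻¹ * halfTurn` leads one step along the level, to the dart that leads back. -/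
def leftDartElt (g₀ : (coxeter hp hq).Group) : Addr → (coxeter hp hq).Group
  | [] => g₀
  | x :: v => leftDartElt g₀ v * rot hp hq ^ x.1 * halfTurn hp hq *
      if x.2 = 0 then rot hp hq else ((rot hp hq)⁻¹ * halfTurn hp hq) ^ x.2

theorem leftDartElt_mul_rot_pow_deg (g₀ : (coxeter hp hq).Group) (v : Addr) (k j : ℕ) :
    leftDartElt g₀ ((k, j) :: v) * rot hp hq ^ (deg q ((k, j) :: v) + 1) * halfTurn hp hq =
      leftDartElt g₀ v * rot hp hq ^ k *
        (halfTurn hp hq * ((rot hp hq)⁻¹ * halfTurn hp hq) ^ (j + 1)) := by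
  have h : (if j = 0 then rot hp hq else ((rot hp hq)⁻¹ * halfTurn hp hq) ^ j) *
      rot hp hq ^ (deg q ((k, j) :: v) + 1) = ((rot hp hq)⁻¹ * halfTurn hp hq) ^ j * (rot hp hq)⁻¹ := by
    simp only [deg]
    split_ifs with hj
    · rw [← pow_succ', show q - 3 + 1 + 1 = q - 1 by omega, rot_pow_sub_one, hj, pow_zero, one_mul]
    · rw [show q - 2 + 1 = q - 1 by omega, rot_pow_sub_one]
  rw [leftDartElt, mul_assoc (_ * halfTurn hp hq), h, pow_succ]
  simp only [mul_assoc]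

/-- Closing up a cell: the elements chosen along a level by way of the parents are compatible with
walking along the level. When the walk reaches the next child, this is the relation
`((rot)⁻¹ * halfTurn) ^ p = 1`. -/
theorem leftDartElt_next (g₀ : (coxeter hp hq).Group) {v : Addr} (hv : Valid p q v) (hne : v ≠ []) :
    leftDartElt g₀ (next p q v) =
      leftDartElt g₀ v * rot hp hq ^ (deg q v + 1) * halfTurn hp hq := by
  induction v with
  | nil => exact absurd rfl hne
  | cons x v ih =>
    obtain ⟨k, j⟩ := x
    obtain ⟨hv, ⟨h1, h2⟩, hj⟩ := hv
    dsimp only at h1 h2 hj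
    rw [leftDartElt_mul_rot_pow_deg, next]
    dsimp only
    split_ifs with h3 h4
    · simp [leftDartElt, mul_assoc]
    · have : j + 1 = p - 2 := by
        simp only [width] at hj h3; rw [if_neg (by omega)] at hj h3; omega
      rw [this, halfTurn_mul_pow_sub_two]
      simp [leftDartElt, mul_assoc, pow_succ]
    · obtain rfl : k = deg q v := by omega
      by_cases hn : v = []
      · subst hn
        have : j + 1 = p - 2 := by simp [width] at hj h3; omega
        rw [this, halfTurn_mul_pow_sub_two]
        simp [leftDartElt, next, deg, rot_pow, mul_assoc]
      · have : j + 1 = p - 3 := by simp [width, hn] at hj h3; omega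
        rw [this, halfTurn_mul_pow_sub_three]
        simp [leftDartElt, ih hv hn, mul_assoc, pow_succ]

/-- The group element of a dart (with the cell on its right). -/
def dartElt (g₀ : (coxeter hp hq).Group) (d : Addr × ZMod q) : (coxeter hp hq).Group :=
  leftDartElt g₀ d.1 * rot hp hq ^ d.2.val

theorem dartElt_natCast (g₀ : (coxeter hp hq).Group) (v : Addr) (n : ℕ) :
    dartElt hp hq g₀ (v, (n : ZMod q)) = leftDartElt g₀ v * rot hp hq ^ n := by
  rw [dartElt, ZMod.val_natCast, ← pow_eq_pow_mod n (rot_pow hp hq)]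

theorem dartElt_add_one (g₀ : (coxeter hp hq).Group) (v : Addr) (x : ZMod q) :
    dartElt hp hq g₀ (v, x + 1) = dartElt hp hq g₀ (v, x) * rot hp hq := by
  have : NeZero q := ⟨by omega⟩
  obtain ⟨n, rfl⟩ : ∃ n : ℕ, (n : ZMod q) = x := ⟨_, ZMod.natCast_zmod_val x⟩
  rw [← Nat.cast_succ, dartElt_natCast, dartElt_natCast, pow_succ, mul_assoc]

theorem dartElt_flip_child (g₀ : (coxeter hp hq).Group) {v : Addr} {k : ℕ} (h1 : 1 ≤ k)
    (h2 : k ≤ deg q v) : dartElt hp hq g₀ (flip p q (v, k)) =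
      dartElt hp hq g₀ (v, k) * halfTurn hp hq := by
  rw [flip_child hq v h1 h2, dartElt_natCast, neg_one_eq_natCast hq, dartElt_natCast, rot_pow_sub_one]
  simp [leftDartElt, mul_assoc]

theorem dartElt_flip_right (g₀ : (coxeter hp hq).Group) {v : Addr} (hv : Valid p q v)
    (hne : v ≠ []) : dartElt hp hq g₀ (flip p q (v, ((deg q v + 1 : ℕ) : ZMod q))) =
      dartElt hp hq g₀ (v, ((deg q v + 1 : ℕ) : ZMod q)) * halfTurn hp hq := by
  have h0 : (0 : ZMod q) = ((0 : ℕ) : ZMod q) := by simp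
  rw [flip_right hq hne, dartElt_natCast, h0, dartElt_natCast, leftDartElt_next hp hq g₀ hv hne]
  simp

theorem dartElt_flip (g₀ : (coxeter hp hq).Group) {v : Addr} (hv : Valid p q v) (x : ZMod q) :
    dartElt hp hq g₀ (flip p q (v, x)) = dartElt hp hq g₀ (v, x) * halfTurn hp hq := by
  -- The two remaining kinds of darts are reversals of the two kinds above.
  have back {d : Addr × ZMod q} (hd : flip p q (flip p q d) = d)
      (h : dartElt hp hq g₀ (flip p q (flip p q d)) = dartElt hp hq g₀ (flip p q d) * halfTurn hp hq) :
      dartElt hp hq g₀ (flip p q d) = dartElt hp hq g₀ d * halfTurn hp hq := by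
    rw [hd] at h
    rw [h, mul_assoc, halfTurn_mul_self, mul_one]
  have hff := flip_flip hp hq hv x
  rcases dart_cases hq v x with ⟨k, h1, h2, rfl⟩ | ⟨h, rfl⟩ | ⟨h, rfl⟩ | ⟨k, w, rfl, rfl⟩
  · exact dartElt_flip_child hp hq g₀ h1 h2
  · refine back hff ?_
    rw [flip_left h]
    exact dartElt_flip_right hp hq g₀ (hv.prev hp hq) (prev_ne_nil h)
  · exact dartElt_flip_right hp hq g₀ hv h
  · refine back hff ?_
    rw [flip_parent hq]
    exact dartElt_flip_child hp hq g₀ hv.2.1.1 hv.2.1.2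

/-- The group element of a flag of the model; the inverse of `toFlag`. -/
def flagElt (g₀ : (coxeter hp hq).Group) (x : Dart p q × Bool) : (coxeter hp hq).Group :=
  dartElt hp hq g₀ x.1.1 * if x.2 then (coxeter hp hq).simple 2 else 1

theorem flagElt_reflect (g₀ : (coxeter hp hq).Group) (i : Fin 3) (x : Dart p q × Bool) :
    flagElt hp hq g₀ (reflect hp hq i x) = flagElt hp hq g₀ x * (coxeter hp hq).simple i := by
  have hs (i : Fin 3) := simple_mul_self hp hq i
  have hrot (d : Dart p q) : dartElt hp hq g₀ (rotation p q d).1 = dartElt hp hq g₀ d.1 * rot hp hq :=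
    dartElt_add_one hp hq g₀ _ _
  have hrev (d : Dart p q) : dartElt hp hq g₀ (reversal hp hq d).1 =
      dartElt hp hq g₀ d.1 * halfTurn hp hq := dartElt_flip hp hq g₀ d.2 _
  have h20 : (coxeter hp hq).simple 2 * (coxeter hp hq).simple 0 = halfTurn hp hq := by
    rw [← inv_eq_of_mul_eq_one_left (halfTurn_mul_self hp hq), halfTurn, mul_inv_rev, simple_inv,
      simple_inv]
  obtain ⟨d, ε⟩ := x
  fin_cases i <;> cases ε
  · simp [flagReflection, flagElt, hrev, halfTurn, mul_assoc, hs]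
  · simp [flagReflection, flagElt, hrev, mul_assoc, h20]
  · simp [flagReflection, flagElt, hrot, rot, mul_assoc, hs]
  · have h := hrot ((rotation p q)⁻¹ d)
    rw [show rotation p q ((rotation p q)⁻¹ d) = d from Equiv.apply_symm_apply _ d] at h
    simp [flagReflection, flagElt, h, rot, mul_assoc, hs]
  · simp [flagReflection, flagElt]
  · simp [flagReflection, flagElt, mul_assoc, hs]

theorem flagElt_baseFlag (g₀ : (coxeter hp hq).Group) : flagElt hp hq g₀ baseFlag = g₀ := by
  simp [flagElt, baseFlag, dartElt, leftDartElt]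

/-- The model is not a proper quotient of the mosaic. -/
theorem flagElt_toFlag (g₀ g : (coxeter hp hq).Group) :
    flagElt hp hq g₀ (toFlag hp hq g₀ g) = g := by
  have key (w : (coxeter hp hq).Group) : flagElt hp hq g₀ (toFlag hp hq g₀ (g₀ * w)) = g₀ * w := by
    induction w using CoxeterSystem.simple_induction_right (coxeter hp hq).toCoxeterSystem with
    | one => rw [mul_one, toFlag_self, flagElt_baseFlag]
    | mul_simple_right w i ih =>
      rw [CoxeterMatrix.toCoxeterSystem_simple, ← mul_assoc, toFlag_mul_simple, flagElt_reflect, ih]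
  simpa using key (g₀⁻¹ * g)

theorem rotation_mk {v : Addr} (hv : Valid p q v) (x : ZMod q) :
    rotation p q ⟨(v, x), hv⟩ = ⟨(v, x + 1), hv⟩ := rfl

/-- The model is connected. -/
theorem rotation_reversal_induction {P : Dart p q → Prop} (base : P ⟨([], 0), trivial⟩)
    (hrot : ∀ d, P d → P (rotation p q d)) (hrev : ∀ d, P d → P (reversal hp hq d))
    (d : Dart p q) : P d := by
  have : NeZero q := ⟨by omega⟩
  have around {v : Addr} (hv : Valid p q v) (x y : ZMod q) (h : P ⟨(v, x), hv⟩) : P ⟨(v, y), hv⟩ := by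
    have step (n : ℕ) : P ⟨(v, x + n), hv⟩ := by
      induction n with
      | zero => simpa using h
      | succ n ih =>
        have h := hrot _ ih
        rw [rotation_mk] at h
        simpa [add_assoc] using h
    have := step (y - x).val
    simpa using this
  obtain ⟨⟨v, x⟩, hv⟩ := d
  induction v generalizing x with
  | nil => exact around hv 0 x base
  | cons y v ih =>
    obtain ⟨k, j⟩ := y
    obtain ⟨hv', ⟨h1, h2⟩, hj⟩ := hv
    dsimp only at h1 h2 hj
    induction j generalizing x with
    | zero =>
      have h := hrev _ (ih k hv')
      have he : reversal hp hq ⟨(v, k), hv'⟩ = ⟨((k, 0) :: v, -1), hv', ⟨h1, h2⟩, hj⟩ :=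
        Subtype.ext (flip_child hq v h1 h2)
      rw [he] at h
      exact around _ _ _ h
    | succ j ihj =>
      have hj' : j < width p q v k := by omega
      have h := hrev _ (ihj ((deg q ((k, j) :: v) + 1 : ℕ) : ZMod q) hj')
      have he : reversal hp hq ⟨((k, j) :: v, ((deg q ((k, j) :: v) + 1 : ℕ) : ZMod q)), hv', ⟨h1, h2⟩, hj'⟩ =
          ⟨((k, j + 1) :: v, 0), hv', ⟨h1, h2⟩, hj⟩ :=
        Subtype.ext ((flip_right hq (v := (k, j) :: v) (by simp)).trans (by rw [next, if_pos hj]))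
      rw [he] at h
      exact around _ _ _ h

theorem toFlag_flagElt (g₀ : (coxeter hp hq).Group) (x : Dart p q × Bool) :
    toFlag hp hq g₀ (flagElt hp hq g₀ x) = x := by
  have step (i : Fin 3) (x) (h : toFlag hp hq g₀ (flagElt hp hq g₀ x) = x) :
      toFlag hp hq g₀ (flagElt hp hq g₀ (reflect hp hq i x)) = reflect hp hq i x := by
    rw [flagElt_reflect, toFlag_mul_simple, h]
  have key (d : Dart p q) : toFlag hp hq g₀ (flagElt hp hq g₀ (d, false)) = (d, false) := by
    induction d using rotation_reversal_induction hp hq with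
    | base =>
      exact (congrArg _ (flagElt_baseFlag hp hq g₀)).trans (toFlag_self hp hq g₀)
    | hrot d ih =>
      have h : reflect hp hq 2 (reflect hp hq 1 (d, false)) = (rotation p q d, false) := rfl
      rw [← h]
      exact step 2 _ (step 1 _ ih)
    | hrev d ih =>
      have h : reflect hp hq 2 (reflect hp hq 0 (d, false)) = (reversal hp hq d, false) := rfl
      rw [← h]
      exact step 2 _ (step 0 _ ih)
  obtain ⟨d, ε⟩ := x
  cases ε
  · exact key d
  · have h : reflect hp hq 2 (d, false) = (d, true) := rfl
    rw [← h]
    exact step 2 _ (key d)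

end Group

/-! ### Recognizing belts and levels -/

section Levels

variable {M : CoxeterMatrix (Fin 3)} {o : Vertex M} {lev : Vertex M → ℕ} {clev : Cell M → ℕ}

/-- Numberings of the vertices and of the cells such that a cell numbered `i + 1` has only vertices
numbered `i` and `i + 1`, of which at least one is numbered `i`, and every vertex lies on the inner
side of a cell and, unless it is `o`, on the outer side of another. -/
structure IsLevelFunction (o : Vertex M) (lev : Vertex M → ℕ) (clev : Cell M → ℕ) : Prop where
  eq_zero_iff : ∀ v, lev v = 0 ↔ v = o
  of_onCell : ∀ v c, v.OnCell c → clev c = lev v ∨ clev c = lev v + 1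
  exists_inner : ∀ c, ∃ v : Vertex M, v.OnCell c ∧ clev c = lev v + 1
  exists_below : ∀ v, lev v ≠ 0 → ∃ c, v.OnCell c ∧ clev c = lev v
  exists_above : ∀ v, ∃ c, v.OnCell c ∧ clev c = lev v + 1

namespace IsLevelFunction

theorem le_of_meets (h : IsLevelFunction o lev clev) {c d : Cell M} (hm : c.Meets d) :
    clev c ≤ clev d + 1 := by
  obtain ⟨v, hc, hd⟩ := hm
  rcases h.of_onCell v c hc with h1 | h1 <;> rcases h.of_onCell v d hd with h2 | h2 <;> omega

theorem pos (h : IsLevelFunction o lev clev) (c : Cell M) : clev c ≠ 0 := by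
  obtain ⟨v, -, hv⟩ := h.exists_inner c
  omega

theorem onCell_iff (h : IsLevelFunction o lev clev) (c : Cell M) : o.OnCell c ↔ clev c = 1 := by
  have ho := (h.eq_zero_iff o).2 rfl
  constructor
  · intro hc
    have := h.pos c
    rcases h.of_onCell o c hc with h1 | h1 <;> omega
  · intro hc
    obtain ⟨v, hv, hv'⟩ := h.exists_inner c
    rwa [(h.eq_zero_iff v).1 (by omega)] at hv

theorem exists_meets_iff (h : IsLevelFunction o lev clev) {i : ℕ} (hi : i ≠ 0) {c : Cell M}
    (hc : i ≤ clev c) : (∃ d, clev d = i ∧ c.Meets d) ↔ clev c ≤ i + 1 := by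
  constructor
  · rintro ⟨d, hd, hm⟩
    exact hd ▸ h.le_of_meets hm
  · intro hc'
    obtain ⟨v, hv, hvc⟩ := h.exists_inner c
    rcases hc.eq_or_lt with h1 | h1
    · exact ⟨c, h1.symm, v, hv, hv⟩
    · obtain ⟨d, hd, hd'⟩ := h.exists_below v (by omega)
      exact ⟨d, by omega, v, hv, hd⟩

theorem mem_belt_iff (h : IsLevelFunction o lev clev) :
    ∀ (i : ℕ) (c : Cell M), c ∈ belt o i ↔ clev c = i
  | 0, c => by simpa [belt] using h.pos c
  | 1, c => h.onCell_iff c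
  | 2, c => by
    have hpos := h.pos c
    have h1 := h.exists_meets_iff one_ne_zero (c := c) (by omega)
    simp only [belt, Set.mem_ofPred_eq, h.onCell_iff, h1]
    omega
  | i + 3, c => by
    simp only [belt, Set.mem_ofPred_eq, h.mem_belt_iff (i + 1), h.mem_belt_iff (i + 2)]
    constructor
    · rintro ⟨⟨d, hd, hm⟩, hn⟩
      have h1 := h.le_of_meets hm
      obtain ⟨v, hv, hv'⟩ := hm
      have h2 := h.le_of_meets ⟨v, hv', hv⟩
      rw [h.exists_meets_iff (by omega) (by omega)] at hn
      omega
    · intro hc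
      rw [h.exists_meets_iff (by omega) (by omega), h.exists_meets_iff (by omega) (by omega)]
      omega

theorem mem_level_iff (h : IsLevelFunction o lev clev) (i : ℕ) (v : Vertex M) :
    v ∈ level o i ↔ lev v = i := by
  cases i with
  | zero => exact (h.eq_zero_iff v).symm
  | succ i =>
    simp only [level, Set.mem_ofPred_eq, h.mem_belt_iff]
    constructor
    · rintro ⟨⟨c, hc, hvc⟩, d, hvd, hd⟩
      have h0 : ¬ clev d ≤ i + 1 := fun hle => hd _ hle rfl
      rcases h.of_onCell v c hvc with h1 | h1 <;> rcases h.of_onCell v d hvd with h2 | h2 <;> omega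
    · intro hv
      obtain ⟨c, hc, hc'⟩ := h.exists_below v (by omega)
      obtain ⟨d, hd, hd'⟩ := h.exists_above v
      exact ⟨⟨c, by omega, hc⟩, d, hd, fun j hj => by omega⟩

end IsLevelFunction

end Levels

/-! ### Levels of the vertices and cells of the mosaic -/

/-- A function on flags that is invariant under two of the reflections descends to the cosets of the
subgroup that they generate. -/
theorem eq_of_mk_eq {M : CoxeterMatrix (Fin 3)} {i j : Fin 3} {T : Type*} {f : M.Group → T}
    (hi : ∀ g, f (g * M.simple i) = f g) (hj : ∀ g, f (g * M.simple j) = f g) {g h : M.Group}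
    (hgh : (QuotientGroup.mk g : M.Group ⧸ pairSubgroup M i j) = QuotientGroup.mk h) : f g = f h := by
  have key {x : M.Group} (hx : x ∈ pairSubgroup M i j) : ∀ g, f (g * x) = f g := by
    induction hx using Subgroup.closure_induction with
    | mem x hx =>
      rcases hx with rfl | rfl
      exacts [hi, hj]
    | one => simp
    | mul x y _ _ hx hy => intro g; rw [← mul_assoc, hy, hx]
    | inv x _ hx => intro g; rw [← hx (g * x⁻¹), inv_mul_cancel_right]
  rw [← key (QuotientGroup.eq.1 hgh) g, mul_inv_cancel_left]

section Group
variable {p q : ℕ} (hp : 3 < p) (hq : 3 < q) (g₀ : (coxeter hp hq).Group)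

/-- The address of a vertex of the mosaic. -/
noncomputable def vertexAddr (v : Vertex (coxeter hp hq)) : Addr :=
  (toFlag hp hq g₀ v.out).1.1.1

/-- The belt of the cell of a flag of the model. -/
def flagCellLevel (x : Dart p q × Bool) : ℕ :=
  if x.2 then dartCellLevel q ((rotation p q)⁻¹ x.1).1 else dartCellLevel q x.1.1

/-- The belt of a cell of the mosaic. -/
noncomputable def cellLevel (c : Cell (coxeter hp hq)) : ℕ :=
  flagCellLevel (toFlag hp hq g₀ c.out)

theorem vertexAddr_mk (g : (coxeter hp hq).Group) :
    vertexAddr hp hq g₀ (QuotientGroup.mk g) = (toFlag hp hq g₀ g).1.1.1 := by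
  refine eq_of_mk_eq (f := fun g => (toFlag hp hq g₀ g).1.1.1) (i := 1) (j := 2) (fun g => ?_)
    (fun g => ?_) (QuotientGroup.out_eq' _)
  · rw [toFlag_mul_simple]
    rcases toFlag hp hq g₀ g with ⟨d, _ | _⟩ <;> rfl
  · rw [toFlag_mul_simple]
    rfl

theorem flagCellLevel_reflect_zero (x : Dart p q × Bool) :
    flagCellLevel (reflect hp hq 0 x) = flagCellLevel x := by
  have h (d : Dart p q) : dartCellLevel q ((rotation p q)⁻¹ (reversal hp hq d)).1 = dartCellLevel q d.1 :=
    dartCellLevel_turn hq d.2 _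
  obtain ⟨d, _ | _⟩ := x
  · exact h d
  · have := h (reversal hp hq d)
    rw [reversal_reversal] at this
    exact this.symm

theorem flagCellLevel_reflect_one (x : Dart p q × Bool) :
    flagCellLevel (reflect hp hq 1 x) = flagCellLevel x := by
  obtain ⟨d, _ | _⟩ := x
  · have h : (rotation p q)⁻¹ (rotation p q d) = d := Equiv.symm_apply_apply _ d
    simp [flagReflection, flagCellLevel, h]
  · simp [flagReflection, flagCellLevel]

theorem cellLevel_mk (g : (coxeter hp hq).Group) :
    cellLevel hp hq g₀ (QuotientGroup.mk g) = flagCellLevel (toFlag hp hq g₀ g) := by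
  refine eq_of_mk_eq (f := fun g => flagCellLevel (toFlag hp hq g₀ g)) (i := 0) (j := 1) (fun g => ?_)
    (fun g => ?_) (QuotientGroup.out_eq' _)
  · rw [toFlag_mul_simple, flagCellLevel_reflect_zero]
  · rw [toFlag_mul_simple, flagCellLevel_reflect_one]

theorem valid_vertexAddr (v : Vertex (coxeter hp hq)) : Valid p q (vertexAddr hp hq g₀ v) :=
  (toFlag hp hq g₀ v.out).1.2

theorem simple_mem_left (M : CoxeterMatrix (Fin 3)) (i j : Fin 3) :
    M.simple i ∈ pairSubgroup M i j := Subgroup.subset_closure (by simp)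

theorem simple_mem_right (M : CoxeterMatrix (Fin 3)) (i j : Fin 3) :
    M.simple j ∈ pairSubgroup M i j := Subgroup.subset_closure (by simp)

theorem mk_flagElt (x : Dart p q × Bool) :
    (QuotientGroup.mk (flagElt hp hq g₀ x) : Vertex (coxeter hp hq)) =
      QuotientGroup.mk (leftDartElt g₀ x.1.1.1) := by
  have h1 := simple_mem_left (coxeter hp hq) 1 2
  have h2 := simple_mem_right (coxeter hp hq) 1 2
  rw [flagElt, dartElt, QuotientGroup.mk_mul_of_mem, QuotientGroup.mk_mul_of_mem]
  · exact pow_mem (mul_mem h1 h2) _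
  · split_ifs
    exacts [h2, one_mem _]

theorem vertexAddr_injective : Function.Injective (vertexAddr hp hq g₀) := by
  have key (v : Vertex (coxeter hp hq)) :
      v = QuotientGroup.mk (leftDartElt g₀ (vertexAddr hp hq g₀ v)) := by
    rw [vertexAddr, ← mk_flagElt, flagElt_toFlag]
    exact (QuotientGroup.out_eq' _).symm
  intro u v h
  rw [key u, key v, h]

/-- The flag of the mosaic at the vertex with address `v`, at its edge `x` and with the cell on its
right. -/
def corner {v : Addr} (hv : Valid p q v) (x : ZMod q) : (coxeter hp hq).Group :=
  flagElt hp hq g₀ (⟨(v, x), hv⟩, false)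

theorem vertexAddr_corner {v : Addr} (hv : Valid p q v) (x : ZMod q) :
    vertexAddr hp hq g₀ (QuotientGroup.mk (corner hp hq g₀ hv x)) = v := by
  rw [vertexAddr_mk, corner, toFlag_flagElt]

theorem cellLevel_corner {v : Addr} (hv : Valid p q v) (x : ZMod q) :
    cellLevel hp hq g₀ (QuotientGroup.mk (corner hp hq g₀ hv x)) = dartCellLevel q (v, x) := by
  rw [cellLevel_mk, corner, toFlag_flagElt]
  rfl

theorem exists_corner_of_vertex (v : Vertex (coxeter hp hq)) (x : ZMod q) :
    v = QuotientGroup.mk (corner hp hq g₀ (valid_vertexAddr hp hq g₀ v) x) :=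
  vertexAddr_injective hp hq g₀ (vertexAddr_corner hp hq g₀ _ _).symm

theorem cellLevel_of_onCell {v : Vertex (coxeter hp hq)} {c : Cell (coxeter hp hq)} (h : v.OnCell c) :
    cellLevel hp hq g₀ c = (vertexAddr hp hq g₀ v).length ∨
      cellLevel hp hq g₀ c = (vertexAddr hp hq g₀ v).length + 1 := by
  have key (d : Addr × ZMod q) : dartCellLevel q d = d.1.length ∨ dartCellLevel q d = d.1.length + 1 := by
    rw [dartCellLevel]; split_ifs <;> simp
  obtain ⟨g, rfl, rfl⟩ := h
  rw [cellLevel_mk, vertexAddr_mk]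
  rcases toFlag hp hq g₀ g with ⟨d, _ | _⟩
  · exact key d.1
  · exact key ((rotation p q)⁻¹ d).1

/-- Every cell lies to the right of a dart that leads to a child, hence has a vertex on the level
below. -/
theorem exists_child_corner_of_cell (c : Cell (coxeter hp hq)) :
    ∃ (v : Addr) (hv : Valid p q v) (k : ℕ), k ≤ deg q v ∧
      c = QuotientGroup.mk (corner hp hq g₀ hv k) := by
  have h0 := simple_mem_left (coxeter hp hq) 0 1
  have h1 := simple_mem_right (coxeter hp hq) 0 1
  have step (d : Dart p q) :
      (QuotientGroup.mk (flagElt hp hq g₀ (((rotation p q)⁻¹ * reversal hp hq) d, false)) :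
        Cell (coxeter hp hq)) = QuotientGroup.mk (flagElt hp hq g₀ (d, false)) := by
    have h : reflect hp hq 1 (reflect hp hq 0 (d, false)) =
      (((rotation p q)⁻¹ * reversal hp hq) d, false) := rfl
    rw [← h, flagElt_reflect, flagElt_reflect, QuotientGroup.mk_mul_of_mem _ h1,
      QuotientGroup.mk_mul_of_mem _ h0]
  have iter (n : ℕ) (d : Dart p q) :
      (QuotientGroup.mk (flagElt hp hq g₀ ((((rotation p q)⁻¹ * reversal hp hq) ^ n) d, false)) :
        Cell (coxeter hp hq)) = QuotientGroup.mk (flagElt hp hq g₀ (d, false)) := by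
    induction n with
    | zero => rfl
    | succ n ih => rw [pow_succ', Equiv.Perm.mul_apply, step, ih]
  obtain ⟨d, hd⟩ : ∃ d : Dart p q, c = QuotientGroup.mk (flagElt hp hq g₀ (d, false)) := by
    obtain ⟨g, rfl⟩ := QuotientGroup.mk_surjective c
    have hg := flagElt_toFlag hp hq g₀ g
    rcases hx : toFlag hp hq g₀ g with ⟨d, _ | _⟩
    · exact ⟨d, by rw [← hx, hg]⟩
    · have h : reflect hp hq 1 (d, true) = ((rotation p q)⁻¹ d, false) := rfl
      exact ⟨(rotation p q)⁻¹ d, by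
        rw [← h, flagElt_reflect, ← hx, hg, QuotientGroup.mk_mul_of_mem _ h1]⟩
  obtain ⟨v, k, m, hv, -, hk, hm⟩ := exists_turn_iterate hp hq d.2 d.1.2
  refine ⟨v, hv, k, hk, ?_⟩
  rw [hd, corner, ← iter m ⟨(v, k), hv⟩]
  congr 3
  exact Subtype.ext (hm.symm.trans (rotation_inv_mul_reversal_pow_apply hp hq m ⟨(v, k), hv⟩).symm)

theorem isLevelFunction : IsLevelFunction (QuotientGroup.mk g₀ : Vertex (coxeter hp hq))
    (fun v => (vertexAddr hp hq g₀ v).length) (cellLevel hp hq g₀) where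
  eq_zero_iff v := by
    have h : vertexAddr hp hq g₀ (QuotientGroup.mk g₀) = [] := by
      rw [vertexAddr_mk, toFlag_self]; rfl
    rw [List.length_eq_zero_iff, ← h]
    exact (vertexAddr_injective hp hq g₀).eq_iff
  of_onCell v c h := cellLevel_of_onCell hp hq g₀ h
  exists_inner c := by
    obtain ⟨v, hv, k, hk, rfl⟩ := exists_child_corner_of_cell hp hq g₀ c
    refine ⟨_, ⟨_, rfl, rfl⟩, ?_⟩
    rw [cellLevel_corner, vertexAddr_corner, dartCellLevel_child _ hk]
  exists_below v hv := by
    refine ⟨_, ⟨_, (exists_corner_of_vertex hp hq g₀ v (-1)).symm, rfl⟩, ?_⟩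
    rw [cellLevel_corner, dartCellLevel_neg_one hq (by simpa using hv)]
  exists_above v := by
    refine ⟨_, ⟨_, (exists_corner_of_vertex hp hq g₀ v 0).symm, rfl⟩, ?_⟩
    rw [cellLevel_corner, dartCellLevel_left]

/-! ### Edges between levels -/

/-- The edges of the mosaic between two levels lead from a vertex to its children. -/
theorem adj_iff_of_length {u v : Vertex (coxeter hp hq)}
    (h : (vertexAddr hp hq g₀ v).length = (vertexAddr hp hq g₀ u).length + 1) :
    (lattice (coxeter hp hq)).Adj u v ↔
      ∃ k, vertexAddr hp hq g₀ v = (k, 0) :: vertexAddr hp hq g₀ u := by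
  constructor
  · rintro ⟨-, e, ⟨a, rfl, ha⟩, b, rfl, hb⟩
    have hab := eq_of_mk_eq (i := 0) (j := 2)
      (f := fun g => ({(toFlag hp hq g₀ g).1, reversal hp hq (toFlag hp hq g₀ g).1} : Set (Dart p q)))
      (fun g => by
        rw [toFlag_mul_simple]
        change ({reversal hp hq _, reversal hp hq (reversal hp hq _)} : Set (Dart p q)) = _
        rw [reversal_reversal, Set.pair_comm]
        rfl)
      (fun g => by
        rw [toFlag_mul_simple]
        rfl) (ha.trans hb.symm)
    rw [vertexAddr_mk, vertexAddr_mk] at h ⊢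
    generalize (toFlag hp hq g₀ a).1 = d at *
    generalize (toFlag hp hq g₀ b).1 = d' at *
    have hd : d' ∈ ({d, reversal hp hq d} : Set (Dart p q)) := by rw [hab]; simp
    rcases hd with rfl | rfl
    · omega
    obtain ⟨⟨u, x⟩, hu⟩ := d
    rw [reversal_val] at h ⊢
    dsimp only at h ⊢
    rcases dart_cases hq u x with ⟨k, h1, h2, rfl⟩ | ⟨hn, rfl⟩ | ⟨hn, rfl⟩ | ⟨k, w, rfl, rfl⟩
    · rw [flip_child hq u h1 h2]; exact ⟨k, rfl⟩
    · rw [flip_left hn] at h; simp at h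
    · rw [flip_right hq hn] at h; simp at h
    · rw [flip_parent hq] at h; simp at h; omega
  · rintro ⟨k, hk⟩
    refine ⟨fun huv => by rw [huv] at h; omega, ?_⟩
    have hv := valid_vertexAddr hp hq g₀ v
    rw [hk] at hv
    have hu := valid_vertexAddr hp hq g₀ u
    refine ⟨QuotientGroup.mk (corner hp hq g₀ hu k),
      ⟨_, (exists_corner_of_vertex hp hq g₀ u k).symm, rfl⟩,
      corner hp hq g₀ hu k * (coxeter hp hq).simple 0, ?_,
      QuotientGroup.mk_mul_of_mem _ (simple_mem_left _ _ _)⟩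
    apply vertexAddr_injective hp hq g₀
    rw [corner, ← flagElt_reflect, vertexAddr_mk, toFlag_flagElt, hk]
    exact congrArg Prod.fst (flip_child hq _ hv.2.1.1 hv.2.1.2)

end Group

/-! ### Counting addresses -/

section Counting

variable (p q : ℕ)

/-- The addresses of the children of the vertices in `S`. -/
def childAddrs (S : Finset Addr) : Finset Addr :=
  (S.sigma fun v => Finset.Icc 1 (deg q v)).image fun x => (x.2, 0) :: x.1

/-- The addresses of the vertices that follow the children of the vertices in `S` on their level. -/
def rootAddrs (S : Finset Addr) : Finset Addr :=
  (S.sigma fun v => (Finset.Icc 1 (deg q v)).sigma fun k => Finset.Ioo 0 (width p q v k)).image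
    fun x => (x.2.1, x.2.2) :: x.1

/-- The addresses of the vertices on a level. -/
def levelAddrs : ℕ → Finset Addr
  | 0 => {[]}
  | n + 1 => childAddrs q (levelAddrs n) ∪ rootAddrs p q (levelAddrs n)

variable {p q}

theorem cons_mem_childAddrs {S : Finset Addr} {x : ℕ × ℕ} {v : Addr} :
    x :: v ∈ childAddrs q S ↔ v ∈ S ∧ (1 ≤ x.1 ∧ x.1 ≤ deg q v) ∧ x.2 = 0 := by
  obtain ⟨k, j⟩ := x
  simp only [childAddrs, Finset.mem_image, Finset.mem_sigma, Finset.mem_Icc]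
  constructor
  · rintro ⟨⟨w, i⟩, ⟨h1, h2⟩, h⟩
    cases h
    exact ⟨h1, h2, rfl⟩
  · rintro ⟨h1, h2, h3⟩
    subst h3
    exact ⟨⟨v, k⟩, ⟨h1, h2⟩, rfl⟩

theorem cons_mem_rootAddrs {S : Finset Addr} {x : ℕ × ℕ} {v : Addr} :
    x :: v ∈ rootAddrs p q S ↔
      v ∈ S ∧ (1 ≤ x.1 ∧ x.1 ≤ deg q v) ∧ 0 < x.2 ∧ x.2 < width p q v x.1 := by
  obtain ⟨k, j⟩ := x
  simp only [rootAddrs, Finset.mem_image, Finset.mem_sigma, Finset.mem_Icc, Finset.mem_Ioo]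
  constructor
  · rintro ⟨⟨w, i, l⟩, ⟨h1, h2, h3⟩, h⟩
    cases h
    exact ⟨h1, h2, h3⟩
  · rintro ⟨h1, h2, h3⟩
    exact ⟨⟨v, k, j⟩, ⟨h1, h2, h3⟩, rfl⟩

theorem nil_notMem_childAddrs {S : Finset Addr} : [] ∉ childAddrs q S := by
  simp [childAddrs]

theorem nil_notMem_rootAddrs {S : Finset Addr} : [] ∉ rootAddrs p q S := by
  simp [rootAddrs]

theorem disjoint_childAddrs_rootAddrs (S T : Finset Addr) :
    Disjoint (childAddrs q S) (rootAddrs p q T) := by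
  rw [Finset.disjoint_left]
  intro l h1 h2
  cases l with
  | nil => exact nil_notMem_childAddrs h1
  | cons x v =>
    have h3 := (cons_mem_childAddrs.1 h1).2.2
    have h4 := (cons_mem_rootAddrs.1 h2).2.2.1
    omega

theorem mem_levelAddrs (hp : 3 < p) (n : ℕ) (l : Addr) :
    l ∈ levelAddrs p q n ↔ Valid p q l ∧ l.length = n := by
  induction n generalizing l with
  | zero => cases l <;> simp [levelAddrs, Valid]
  | succ n ih =>
    rw [levelAddrs, Finset.mem_union]
    cases l with
    | nil => simp [nil_notMem_childAddrs, nil_notMem_rootAddrs]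
    | cons x v =>
      have := one_le_width (q := q) hp v x.1
      rw [cons_mem_childAddrs, cons_mem_rootAddrs, ih, Valid, List.length_cons]
      constructor
      · rintro (⟨⟨h1, h2⟩, h3, h4⟩ | ⟨⟨h1, h2⟩, h3, h4, h5⟩)
        · exact ⟨⟨h1, h3, by omega⟩, by omega⟩
        · exact ⟨⟨h1, h3, h5⟩, by omega⟩
      · rintro ⟨⟨h1, h2, h3⟩, h4⟩
        rcases Nat.eq_zero_or_pos x.2 with h | h
        · exact Or.inl ⟨⟨h1, by omega⟩, h2, h⟩
        · exact Or.inr ⟨⟨h1, by omega⟩, h2, h, h3⟩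

theorem card_childAddrs (S : Finset Addr) : (childAddrs q S).card = ∑ v ∈ S, deg q v := by
  rw [childAddrs, Finset.card_image_of_injective, Finset.card_sigma]
  · simp
  · rintro ⟨v, k⟩ ⟨w, l⟩ h
    cases h
    rfl

theorem card_rootAddrs (S : Finset Addr) :
    (rootAddrs p q S).card = ∑ v ∈ S, ∑ k ∈ Finset.Icc 1 (deg q v), (width p q v k - 1) := by
  rw [rootAddrs, Finset.card_image_of_injective, Finset.card_sigma]
  · simp
  · rintro ⟨v, k, j⟩ ⟨w, l, i⟩ h
    cases h
    rfl

theorem sum_width_sub_one_nil (hp : 3 < p) :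
    ((∑ k ∈ Finset.Icc 1 (deg q []), (width p q [] k - 1) : ℕ) : ℤ) = q * (p - 3) := by
  simp only [width, deg, ne_eq, not_true_eq_false, false_and, if_false, Finset.sum_const,
    Nat.card_Icc, smul_eq_mul, Nat.add_sub_cancel]
  push_cast [show p - 2 - 1 = p - 3 by omega, Nat.cast_sub hp.le]
  rfl

theorem sum_width_sub_one (hp : 3 < p) (hq : 3 < q) {v : Addr} (hv : v ≠ []) :
    ((∑ k ∈ Finset.Icc 1 (deg q v), (width p q v k - 1) : ℕ) : ℤ) = deg q v * (p - 3) - 1 := by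
  obtain ⟨d, hd⟩ : ∃ d, deg q v = d + 1 := ⟨_, (Nat.sub_add_cancel (one_le_deg hq v)).symm⟩
  have h : ∀ k ∈ Finset.Icc 1 d, width p q v k - 1 = p - 3 := fun k hk => by
    rw [Finset.mem_Icc] at hk
    rw [width, if_neg (by omega)]; omega
  have h' : width p q v (d + 1) - 1 = p - 4 := by
    rw [width, if_pos ⟨hv, hd.symm⟩]; omega
  rw [hd, Finset.sum_Icc_succ_top (by omega), Finset.sum_congr rfl h, h', Finset.sum_const,
    Nat.card_Icc, smul_eq_mul, Nat.add_sub_cancel]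
  push_cast [Nat.cast_sub hp.le, Nat.cast_sub (show 4 ≤ p from hp)]
  ring

theorem deg_of_mem_childAddrs {S : Finset Addr} {v : Addr} (hv : v ∈ childAddrs q S) :
    v ≠ [] ∧ deg q v = q - 3 := by
  cases v with
  | nil => exact absurd hv nil_notMem_childAddrs
  | cons x v => exact ⟨by simp, by rw [deg, if_pos (cons_mem_childAddrs.1 hv).2.2]⟩

theorem deg_of_mem_rootAddrs {S : Finset Addr} {v : Addr} (hv : v ∈ rootAddrs p q S) :
    v ≠ [] ∧ deg q v = q - 2 := by
  cases v with
  | nil => exact absurd hv nil_notMem_rootAddrs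
  | cons x v => exact ⟨by simp, by rw [deg, if_neg (cons_mem_rootAddrs.1 hv).2.2.1.ne']⟩

theorem sum_levelAddrs_succ (f : Addr → ℤ) {a b : ℤ} (n : ℕ)
    (ha : ∀ v, v ≠ [] → deg q v = q - 3 → f v = a) (hb : ∀ v, v ≠ [] → deg q v = q - 2 → f v = b) :
    ∑ v ∈ levelAddrs p q (n + 1), f v = a * (childAddrs q (levelAddrs p q n)).card +
      b * (rootAddrs p q (levelAddrs p q n)).card := by
  rw [levelAddrs, Finset.sum_union (disjoint_childAddrs_rootAddrs _ _),
    Finset.sum_congr rfl fun v hv => ha v (deg_of_mem_childAddrs hv).1 (deg_of_mem_childAddrs hv).2,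
    Finset.sum_congr rfl fun v hv => hb v (deg_of_mem_rootAddrs hv).1 (deg_of_mem_rootAddrs hv).2]
  simp [mul_comm]

theorem card_childAddrs_succ (hq : 3 < q) (n : ℕ) :
    ((childAddrs q (levelAddrs p q (n + 1))).card : ℤ) =
      (q - 3) * (childAddrs q (levelAddrs p q n)).card +
      (q - 2) * (rootAddrs p q (levelAddrs p q n)).card := by
  rw [card_childAddrs, Nat.cast_sum]
  refine sum_levelAddrs_succ _ n (fun v _ hv => ?_) (fun v _ hv => ?_) <;> rw [hv] <;> omega

theorem card_rootAddrs_succ (hp : 3 < p) (hq : 3 < q) (n : ℕ) :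
    ((rootAddrs p q (levelAddrs p q (n + 1))).card : ℤ) =
      ((q - 3) * (p - 3) - 1) * (childAddrs q (levelAddrs p q n)).card +
      ((q - 2) * (p - 3) - 1) * (rootAddrs p q (levelAddrs p q n)).card := by
  rw [card_rootAddrs, Nat.cast_sum]
  refine sum_levelAddrs_succ _ n (fun v h0 hv => ?_) (fun v h0 hv => ?_) <;>
    rw [sum_width_sub_one hp hq h0, hv, Nat.cast_sub (by omega)] <;> norm_num

end Counting

/-! ### Tree constructions -/

section Trees

variable {p q : ℕ} (hp : 3 < p) (hq : 3 < q) (g₀ : (coxeter hp hq).Group)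

/-- The graph of all edges of the mosaic that join consecutive levels. -/
def interlevel (hp : 3 < p) (hq : 3 < q) (g₀ : (coxeter hp hq).Group) :
    SimpleGraph (Vertex (coxeter hp hq)) where
  Adj u v := (∃ k, vertexAddr hp hq g₀ v = (k, 0) :: vertexAddr hp hq g₀ u) ∨
    ∃ k, vertexAddr hp hq g₀ u = (k, 0) :: vertexAddr hp hq g₀ v
  symm := ⟨fun _ _ h => h.symm⟩
  loopless := ⟨fun v h => by
    rcases h with ⟨k, h⟩ | ⟨k, h⟩ <;> simpa using congrArg List.length h⟩

/-- The pairs of a vertex on level `i` and one of its children. -/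
def parentPairs (i : ℕ) : Set (Vertex (coxeter hp hq) × Vertex (coxeter hp hq)) :=
  {e | (vertexAddr hp hq g₀ e.1).length = i ∧
    ∃ k, vertexAddr hp hq g₀ e.2 = (k, 0) :: vertexAddr hp hq g₀ e.1}

theorem mem_level (i : ℕ) (v : Vertex (coxeter hp hq)) :
    v ∈ level (QuotientGroup.mk g₀ : Vertex (coxeter hp hq)) i ↔
      (vertexAddr hp hq g₀ v).length = i :=
  (isLevelFunction hp hq g₀).mem_level_iff i v

theorem edgesBetween_subset {F : SimpleGraph (Vertex (coxeter hp hq))}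
    (hF : F ≤ lattice (coxeter hp hq)) (i : ℕ) :
    edgesBetween (QuotientGroup.mk g₀) F i ⊆ parentPairs hp hq g₀ i := by
  rintro ⟨u, v⟩ ⟨hu, hv, hadj⟩
  rw [mem_level] at hu hv
  exact ⟨hu, (adj_iff_of_length hp hq g₀ (by rw [hu, hv])).1 (hF hadj)⟩

theorem edgesBetween_interlevel (i : ℕ) :
    edgesBetween (QuotientGroup.mk g₀) (interlevel hp hq g₀) i = parentPairs hp hq g₀ i := by
  ext ⟨u, v⟩
  simp only [edgesBetween, parentPairs, Set.mem_ofPred_eq, mem_level]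
  constructor
  · rintro ⟨hu, hv, h | ⟨k, h⟩⟩
    · exact ⟨hu, h⟩
    · simp [h] at hu; omega
  · rintro ⟨hu, k, hk⟩
    exact ⟨hu, by rw [hk, List.length_cons, hu], Or.inl ⟨k, hk⟩⟩

theorem isTreeConstruction_interlevel :
    IsTreeConstruction (QuotientGroup.mk g₀) (interlevel hp hq g₀) where
  le_lattice u v h := by
    rcases h with h | h
    · have hl := h
      obtain ⟨k, hk⟩ := hl
      exact (adj_iff_of_length hp hq g₀ (by simp [hk])).2 h
    · have hl := h
      obtain ⟨k, hk⟩ := hl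
      exact ((adj_iff_of_length hp hq g₀ (by simp [hk])).2 h).symm
  consecutive u v h := by
    simp only [edgesBetween_interlevel]
    rcases h with h | h
    · exact ⟨_, Or.inl ⟨rfl, h⟩⟩
    · exact ⟨_, Or.inr ⟨rfl, h⟩⟩
  unique_parent i u u' v h h' := by
    rw [edgesBetween_interlevel] at h h'
    obtain ⟨-, k, hk⟩ := h
    obtain ⟨-, k', hk'⟩ := h'
    dsimp only at hk hk'
    rw [hk] at hk'
    exact vertexAddr_injective hp hq g₀ (List.cons.inj hk').2
  no_leaf i u hu := by
    rw [mem_level] at hu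
    have hv : Valid p q ((1, 0) :: vertexAddr hp hq g₀ u) :=
      ⟨valid_vertexAddr hp hq g₀ u, ⟨le_rfl, one_le_deg hq _⟩, one_le_width hp _ _⟩
    refine ⟨QuotientGroup.mk (corner hp hq g₀ hv 0), ?_⟩
    rw [edgesBetween_interlevel]
    exact ⟨hu, 1, vertexAddr_corner hp hq g₀ hv 0⟩
  maximum F hF i := by
    rw [edgesBetween_interlevel]
    exact Set.encard_le_encard (edgesBetween_subset hp hq g₀ hF.le_lattice i)

theorem finite_preimage_vertexAddr (S : Finset Addr) :
    (vertexAddr hp hq g₀ ⁻¹' (S : Set Addr)).Finite :=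
  S.finite_toSet.preimage (vertexAddr_injective hp hq g₀).injOn

theorem ncard_preimage_vertexAddr {S : Finset Addr} (hS : ∀ l ∈ S, Valid p q l) :
    (vertexAddr hp hq g₀ ⁻¹' (S : Set Addr)).ncard = S.card := by
  rw [Set.ncard_preimage_of_injective_subset_range (vertexAddr_injective hp hq g₀),
    Set.ncard_coe_finset]
  exact fun l hl => ⟨_, vertexAddr_corner hp hq g₀ (hS l hl) 0⟩

theorem level_eq_preimage (i : ℕ) : level (QuotientGroup.mk g₀ : Vertex (coxeter hp hq)) i =
    vertexAddr hp hq g₀ ⁻¹' (levelAddrs p q i : Set Addr) := by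
  ext v
  simp [mem_level, mem_levelAddrs hp, valid_vertexAddr]

theorem finite_parentPairs (i : ℕ) : (parentPairs hp hq g₀ i).Finite := by
  refine ((finite_preimage_vertexAddr hp hq g₀ (levelAddrs p q i)).prod
    (finite_preimage_vertexAddr hp hq g₀ (levelAddrs p q (i + 1)))).subset ?_
  rintro ⟨u, v⟩ ⟨hu, k, hk⟩
  simp_all [Set.mem_prod, mem_levelAddrs hp, valid_vertexAddr]
  rw [← hk]
  exact valid_vertexAddr hp hq g₀ v

variable {F : SimpleGraph (Vertex (coxeter hp hq))}

variable {hp hq g₀} in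
/-- A tree construction uses every edge between two levels: all these edges together are admissible,
and there are finitely many of them between two given levels. -/
theorem edgesBetween_eq (hF : IsTreeConstruction (QuotientGroup.mk g₀) F) (i : ℕ) :
    edgesBetween (QuotientGroup.mk g₀) F i = parentPairs hp hq g₀ i := by
  refine (finite_parentPairs hp hq g₀ i).eq_of_subset_of_encard_le'
    (edgesBetween_subset hp hq g₀ hF.le_lattice i) ?_
  rw [← edgesBetween_interlevel]
  exact hF.maximum _ (isTreeConstruction_interlevel hp hq g₀).toIsAdmissible i

variable {hp hq g₀} in
theorem nonRoots_succ_eq (hF : IsTreeConstruction (QuotientGroup.mk g₀) F) (i : ℕ) :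
    nonRoots (QuotientGroup.mk g₀) F (i + 1) =
      vertexAddr hp hq g₀ ⁻¹' (childAddrs q (levelAddrs p q i) : Set Addr) := by
  ext v
  have hv := valid_vertexAddr hp hq g₀ v
  simp only [nonRoots, edgesBetween_eq hF, parentPairs, Set.mem_ofPred_eq, Set.mem_preimage,
    Finset.mem_coe]
  constructor
  · rintro ⟨j, u, hj, hu, k, hk⟩
    obtain rfl : j = i := by omega
    rw [hk] at hv ⊢
    exact cons_mem_childAddrs.2 ⟨(mem_levelAddrs hp _ _).2 ⟨hv.1, hu⟩, hv.2.1, rfl⟩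
  · intro h
    cases hl : vertexAddr hp hq g₀ v with
    | nil => rw [hl] at h; exact absurd h nil_notMem_childAddrs
    | cons x w =>
      obtain ⟨k, j⟩ := x
      rw [hl] at h
      obtain ⟨hw, -, hj⟩ := cons_mem_childAddrs.1 h
      obtain ⟨hw, hwl⟩ := (mem_levelAddrs hp _ _).1 hw
      dsimp only at hj
      have := vertexAddr_corner hp hq g₀ hw 0
      exact ⟨i, _, rfl, by rw [this, hwl], k, by rw [this, hj]⟩

variable {hp hq g₀} in
theorem roots_succ_eq (hF : IsTreeConstruction (QuotientGroup.mk g₀) F) (i : ℕ) :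
    roots (QuotientGroup.mk g₀) F (i + 1) =
      vertexAddr hp hq g₀ ⁻¹' (rootAddrs p q (levelAddrs p q i) : Set Addr) := by
  rw [roots, nonRoots_succ_eq hF, level_eq_preimage hp, ← Set.preimage_sdiff, ← Finset.coe_sdiff,
    levelAddrs, Finset.union_sdiff_cancel_left (disjoint_childAddrs_rootAddrs _ _)]

variable {hp hq g₀} in
theorem finite_nonRoots (hF : IsTreeConstruction (QuotientGroup.mk g₀) F) (i : ℕ) :
    (nonRoots (QuotientGroup.mk g₀) F i).Finite := by
  cases i with
  | zero => simp [nonRoots]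
  | succ i => rw [nonRoots_succ_eq hF]; exact finite_preimage_vertexAddr hp hq g₀ _

theorem finite_roots (i : ℕ) :
    (roots (QuotientGroup.mk g₀) F i).Finite :=
  ((level_eq_preimage hp hq g₀ i) ▸ finite_preimage_vertexAddr hp hq g₀ _).subset Set.sdiff_subset

variable {hp hq g₀} in
theorem ncard_nonRoots_succ (hF : IsTreeConstruction (QuotientGroup.mk g₀) F) (i : ℕ) :
    (nonRoots (QuotientGroup.mk g₀) F (i + 1)).ncard = (childAddrs q (levelAddrs p q i)).card := by
  rw [nonRoots_succ_eq hF]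
  refine ncard_preimage_vertexAddr hp hq g₀ fun l hl => ((mem_levelAddrs hp (i + 1) l).1 ?_).1
  exact Finset.mem_union_left _ hl

variable {hp hq g₀} in
theorem ncard_roots_succ (hF : IsTreeConstruction (QuotientGroup.mk g₀) F) (i : ℕ) :
    (roots (QuotientGroup.mk g₀) F (i + 1)).ncard = (rootAddrs p q (levelAddrs p q i)).card := by
  rw [roots_succ_eq hF]
  refine ncard_preimage_vertexAddr hp hq g₀ fun l hl => ((mem_levelAddrs hp (i + 1) l).1 ?_).1
  exact Finset.mem_union_right _ hl

end Trees
end Mosaic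

theorem lemma1 (p q : ℕ) (hp : 3 < p) (hq : 3 < q)
    (o : Mosaic.Vertex (Mosaic.schlafli p q (by omega) (by omega))) :
    (∃ F, Mosaic.IsTreeConstruction o F) ∧
    ∀ F, Mosaic.IsTreeConstruction o F →
      (∀ i, (Mosaic.nonRoots o F i).Finite ∧ (Mosaic.roots o F i).Finite) ∧
      ((Mosaic.nonRoots o F 1).ncard : ℤ) = q ∧
      ((Mosaic.roots o F 1).ncard : ℤ) = q * (p - 3) ∧
      ∀ i, 1 ≤ i →
        ((Mosaic.nonRoots o F (i + 1)).ncard : ℤ) =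
          (q - 3) * (Mosaic.nonRoots o F i).ncard + (q - 2) * (Mosaic.roots o F i).ncard ∧
        ((Mosaic.roots o F (i + 1)).ncard : ℤ) =
          ((q - 3) * (p - 3) - 1) * (Mosaic.nonRoots o F i).ncard +
          ((q - 2) * (p - 3) - 1) * (Mosaic.roots o F i).ncard := by
  obtain ⟨g₀, rfl⟩ := QuotientGroup.mk_surjective o
  refine ⟨⟨_, Mosaic.isTreeConstruction_interlevel hp hq g₀⟩, fun F hF =>
    ⟨fun i => ⟨Mosaic.finite_nonRoots (hp := hp) (hq := hq) hF i,
      Mosaic.finite_roots hp hq g₀ i⟩, ?_, ?_, fun i hi => ?_⟩⟩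
  · rw [Mosaic.ncard_nonRoots_succ (hp := hp) (hq := hq) hF 0, Mosaic.card_childAddrs]
    simp [Mosaic.levelAddrs, Mosaic.deg]
  · rw [Mosaic.ncard_roots_succ (hp := hp) (hq := hq) hF 0, Mosaic.card_rootAddrs,
      ← Mosaic.sum_width_sub_one_nil hp]
    simp [Mosaic.levelAddrs]
  · obtain ⟨n, rfl⟩ := Nat.exists_eq_add_of_le' hi
    simp only [Mosaic.ncard_nonRoots_succ (hp := hp) (hq := hq) hF,
      Mosaic.ncard_roots_succ (hp := hp) (hq := hq) hF]
    exact ⟨Mosaic.card_childAddrs_succ hq n, Mosaic.card_rootAddrs_succ hp hq n⟩
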